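/- **Setting.** Let $G$ be a linear algebraic group over an algebraically closed field $F$ (a Zariski closed subgroup of some $GL_n(F)$) with a split $BN$-pair: $G$ has closed subgroups $B$ and $N$ such that (i) $B\cup N$ generates $G$, and $T=B\cap N$ is normal in $N$ and consists of semisimple elements; (ii) $W=N/T$ is generated by a set $S=\{s_i : i\in I\}$ of elements of order $2$; (iii) $n_iBn_i\neq B$ whenever $n_i\in N$ maps to $s_i$; (iv) $n_iBn\subseteq Bn_inB\cup BnB$ for all $n\in N$ and all such $n_i$; (v) $B$ has a closed normal unipotent subgroup $U$ with $B=T\ltimes U$; (vi) $\bigcap_{n\in N}nBn^{-1}=T$. (Then $W$ is finite.) Let $l$ be the length function of $(W,S)$ and $w_0$ the longest element of $W$. For $s_i\in S$ let $U_i=U\cap s_i^{-1}U^-s_i$, where $U^-=w_0Uw_0^{-1}$. Let $k$ be any field, $M(tr)=kG\otimes_{kB}k$ the $kG$-module induced from the trivial $B$-module $k$, and $1_{tr}=1\otimes 1$. For $w\in W$ put $w1_{tr}=n_w1_{tr}$, where $n_w\in N$ is a representative of $w$ (the choice does not matter). For $J\subseteq S$ let $W_J$ be the subgroup of $W$ generated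 by $J$, let $\eta_J=\sum_{w\in W_J}(-1)^{l(w)}w1_{tr}$, and let $M(tr)_J=kUW\eta_J$ be the $k$-span of all $un\eta_J$ with $u\in U$, $n\in N$. Let $M(tr)'_J$ be the sum of all $M(tr)_K$ with $J\subsetneq K\subseteq S$. **Proposition.** Assume that every $U_i$ is infinite. Then for each $J\subseteq S$ the subspace $M(tr)_J$ is a $kG$-submodule of $M(tr)$ and it contains $M(tr)'_J$, so that $E_J=M(tr)_J/M(tr)'_J$ is a $kG$-module; and if $J\neq K$ are different subsets of $S$, then the $kG$-modules $E_J$ and $E_K$ are not isomorphic. -/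

import Mathlib

/-- A subgroup of `GL_n(F)` is Zariski closed if it is cut out in `GL_n(F)` by a family of
polynomials in the matrix entries. (Allowing the inverse of the determinant as a further
variable gives the same closed sets, since the determinant is invertible on `GL_n(F)`.)
A linear algebraic group over an algebraically closed field `F` is a Zariski closed subgroup
of some `GL_n(F)`. -/
def IsZariskiClosed {F : Type*} [Field F] {n : ℕ} (H : Subgroup (GL (Fin n) F)) : Prop :=
  ∃ I : Set (MvPolynomial (Fin n × Fin n) F), ∀ g : GL (Fin n) F,
    g ∈ H ↔ ∀ p ∈ I, MvPolynomial.eval (fun ij => (g : Matrix (Fin n) (Fin n) F) ij.1 ij.2) p = 0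

/-- Semisimple elements of `GL_n(F)`: those acting semisimply on `F^n`
(for algebraically closed `F`: diagonalizable). -/
def IsSemisimpleElement {F : Type*} [Field F] {n : ℕ} (g : GL (Fin n) F) : Prop :=
  Module.End.IsSemisimple (Matrix.toLin' (g : Matrix (Fin n) (Fin n) F))

/-- Unipotent elements of `GL_n(F)`: those `g` with `g - 1` nilpotent. -/
def IsUnipotentElement {F : Type*} [Field F] {n : ℕ} (g : GL (Fin n) F) : Prop :=
  IsNilpotent ((g : Matrix (Fin n) (Fin n) F) - 1)

/-- Three subgroups `B`, `N`, `U` of a group, with `T = B ∩ N` normal in `N`, so that the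
group `W = N / T` makes sense. The other axioms of a split `BN`-pair are in
`IsSplitBNPair`. -/
structure BNTriple (Γ : Type*) [Group Γ] where
  B : Subgroup Γ
  N : Subgroup Γ
  U : Subgroup Γ
  normal_T : ((B ⊓ N).subgroupOf N).Normal

namespace BNTriple

variable {Γ : Type*} [Group Γ] (D : BNTriple Γ)

/-- `T = B ∩ N`. -/
def T : Subgroup Γ := D.B ⊓ D.N

instance instNormal : (D.T.subgroupOf D.N).Normal := D.normal_T

/-- `W = N / T`. -/
abbrev W : Type _ := ↥D.N ⧸ D.T.subgroupOf D.N

/-- The natural homomorphism `N → W`. -/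
def toW : ↥D.N →* D.W := QuotientGroup.mk' (D.T.subgroupOf D.N)

/-- The length of `w` with respect to a set `S` of generating involutions of `W`: the least
length of a word in `S` with product `w`. -/
noncomputable def len (S : Set D.W) (w : D.W) : ℕ :=
  sInf {m : ℕ | ∃ l : List D.W, (∀ s ∈ l, s ∈ S) ∧ l.prod = w ∧ l.length = m}

/-- `w` is an element of maximal length of `W`. -/
def IsLongest (S : Set D.W) (w : D.W) : Prop := ∀ v : D.W, D.len S v ≤ D.len S w

/-- The subgroup `U_w = U ∩ w⁻¹ U⁻ w` of `U`, where `U⁻ = w₀ U w₀⁻¹` and `w₀` is the longest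
element of `W`; that is, the set of `u ∈ U` with `(n₀ n) u (n₀ n)⁻¹ ∈ U`, for representatives
`n` of `w` and `n₀` of `w₀`. (As `T` normalizes `U`, the representatives do not matter.)
For `w = s_i` this is the group `U_i`. -/
def Uof (S : Set D.W) (w : D.W) : Subgroup Γ :=
  D.U ⊓ ⨅ (n : ↥D.N) (n₀ : ↥D.N) (_ : D.toW n = w) (_ : D.IsLongest S (D.toW n₀)),
    D.U.comap (MulAut.conj ((n₀ : Γ) * (n : Γ))).toMonoidHom

variable (k : Type*) [Field k]

/-- The representation of the group on `M(tr) = kG ⊗_{kB} k_tr`, the representation induced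
from the trivial representation of `B` on `k`. -/
noncomputable def ind :
    Representation k Γ (Representation.IndV D.B.subtype (Representation.trivial k D.B k)) :=
  Representation.ind D.B.subtype (Representation.trivial k D.B k)

/-- The `kG`-module `M(tr)`. -/
abbrev Mtr : Type _ := (D.ind k).asModule

/-- The element `1_tr = 1 ⊗ 1` of `M(tr)`. -/
noncomputable def oneTr :
    Representation.IndV D.B.subtype (Representation.trivial k D.B k) :=
  Representation.IndV.mk D.B.subtype (Representation.trivial k D.B k) 1 1

/-- The element `w 1_tr = n_w 1_tr`, for a chosen representative `n_w ∈ N` of `w`. -/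
noncomputable def wOneTr (w : D.W) :
    Representation.IndV D.B.subtype (Representation.trivial k D.B k) :=
  D.ind k ((Quotient.out w : ↥D.N) : Γ) (D.oneTr k)

/-- `η_J = ∑_{w ∈ W_J} (-1)^{l(w)} w 1_tr`, where `W_J` is the subgroup generated by `J`. -/
noncomputable def eta (S J : Set D.W) :
    Representation.IndV D.B.subtype (Representation.trivial k D.B k) :=
  ∑ᶠ w ∈ (Subgroup.closure J : Set D.W), (-1 : k) ^ D.len S w • D.wOneTr k w

/-- The subspace `k U W η_J` of `M(tr)`. -/
noncomputable def kUWEta (S J : Set D.W) :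
    Submodule k (Representation.IndV D.B.subtype (Representation.trivial k D.B k)) :=
  Submodule.span k {x | ∃ u ∈ D.U, ∃ n ∈ D.N, x = D.ind k u (D.ind k n (D.eta k S J))}

/-- `M(tr)_J` as a `kG`-submodule of `M(tr)`: the `kG`-submodule spanned by `k U W η_J`.
(If `k U W η_J` is stable under the group, this is just `k U W η_J`.) -/
noncomputable def MtrJ (S J : Set D.W) : Submodule (MonoidAlgebra k Γ) (D.Mtr k) :=
  Submodule.span (MonoidAlgebra k Γ) {x | (D.ind k).asModuleEquiv x ∈ D.kUWEta k S J}

/-- `M(tr)'_J`, the sum of all `M(tr)_K` with `J ⊊ K ⊆ S`. -/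
noncomputable def MtrJ' (S J : Set D.W) : Submodule (MonoidAlgebra k Γ) (D.Mtr k) :=
  ⨆ (K : Set D.W) (_ : J ⊂ K ∧ K ⊆ S), D.MtrJ k S K

/-- The `kG`-module `E_J = M(tr)_J / M(tr)'_J`. -/
abbrev E (S J : Set D.W) : Type _ :=
  ↥(D.MtrJ k S J) ⧸ (D.MtrJ' k S J).submoduleOf (D.MtrJ k S J)

end BNTriple

/-- `(B, N, U)` and the set `S ⊆ W = N / T` form a split `BN`-pair of the linear algebraic
group `G` (a closed subgroup of `GL_n(F)`). -/
structure IsSplitBNPair {F : Type*} [Field F] {n : ℕ} (G : Subgroup (GL (Fin n) F))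
    (D : BNTriple ↥G) (S : Set D.W) : Prop where
  closed_B : IsZariskiClosed (D.B.map G.subtype)
  closed_N : IsZariskiClosed (D.N.map G.subtype)
  /-- `G` is generated by `B ∪ N`. -/
  generate : D.B ⊔ D.N = ⊤
  /-- All elements of `T` are semisimple. -/
  semisimple_T : ∀ t ∈ D.T, IsSemisimpleElement (t : GL (Fin n) F)
  /-- `W` is generated by `S`. -/
  generate_W : Subgroup.closure S = ⊤
  /-- The elements of `S` have order 2. -/
  order_two : ∀ s ∈ S, orderOf s = 2
  /-- `n_i B n_i ≠ B`. -/
  thick : ∀ m : ↥D.N, D.toW m ∈ S → {x : ↥G | ∃ b ∈ D.B, x = m * b * m} ≠ (D.B : Set ↥G)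
  /-- `n_i B m ⊆ B n_i m B ∪ B m B`. -/
  exchange : ∀ ni m : ↥D.N, D.toW ni ∈ S → ∀ b ∈ D.B,
    (ni : ↥G) * b * m ∈ DoubleCoset.doubleCoset ((ni : ↥G) * m) D.B D.B
      ∪ DoubleCoset.doubleCoset (m : ↥G) D.B D.B
  /-- `U` is a closed normal unipotent subgroup of `B`, and `B = T ⋉ U`. -/
  closed_U : IsZariskiClosed (D.U.map G.subtype)
  U_le_B : D.U ≤ D.B
  normal_U : (D.U.subgroupOf D.B).Normal
  unipotent_U : ∀ u ∈ D.U, IsUnipotentElement (u : GL (Fin n) F)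
  T_inf_U : D.T ⊓ D.U = ⊥
  T_sup_U : D.T ⊔ D.U = D.B
  /-- The intersection of all `m B m⁻¹`, `m ∈ N`, is `T`. -/
  saturated : ∀ g : ↥G, (∀ m ∈ D.N, ∃ b ∈ D.B, g = m * b * m⁻¹) ↔ g ∈ D.T

/-! View `M(tr)` as the finitely supported functions on the chambers `gB`. Then `M(tr)_J` consists
of the functions whose sum over every panel of type `s ∈ J` vanishes (`altSpan_eq_cycles`): `η_J`
has this property, and conversely the longest chambers in the support of such a function can be
removed by translates `u n η_J`. This condition is stable under `G` and grows stronger with `J`,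
which gives the submodule claims.

To separate `E_J` from `E_K`, compare stabilizers up to finite index. Let `w_J` be the longest
element of `W_J` and `C_J` the stabilizer in `B` of the chamber `w_J B`. It fixes `η_J`
(`altSum_fixed`), whose class in `E_J` is nonzero (`altSum_notMem`). An isomorphism `E_J → E_K`
yields a nonzero `C_J`-fixed class in `E_K`. Summation over residues of type `S \ K` kills
`M(tr)'_K`, so it turns a representative of that class into an honestly `C_J`-invariant function of
finite support. By `mem_iSup_cycles` this function is nonzero at the residue of some `gB` in `ByB`,
where `y` has right descent set exactly `K`. Finiteness of the support makes the stabilizer of `gB`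
in `C_J` of finite index (`relIndex_ne_zero_of_push`). As `y` is longest in `y W_K`, the stabilizer
of `gB` in `B` lies in a conjugate of `C_K`.

The inverse isomorphism gives the same with `J` and `K` exchanged. The descending chain condition on
closed subgroups (`relIndex_comap_conj_ne_zero`) upgrades the two one-sided statements to
commensurability. An infinite `U_t` that lies in one of these groups but acts freely on the relevant
chambers would contradict it. This forces first `y = w_K` and then `K ⊆ J` (`subset_of_relIndex`);
by symmetry `J = K`. -/

/-! ### Word length for generating involutions. -/

section WordLength

variable {W : Type*} [Group W]

/-- The least length of a word in `S` with product `w`. -/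
noncomputable def wordLen (S : Set W) (w : W) : ℕ :=
  sInf {m : ℕ | ∃ l : List W, (∀ s ∈ l, s ∈ S) ∧ l.prod = w ∧ l.length = m}

theorem wordLen_le_length {S : Set W} {l : List W} (hl : ∀ s ∈ l, s ∈ S) :
    wordLen S l.prod ≤ l.length :=
  Nat.sInf_le ⟨l, hl, rfl, rfl⟩

theorem prod_mem_closure {S : Set W} {l : List W} (hl : ∀ s ∈ l, s ∈ S) :
    l.prod ∈ Subgroup.closure S :=
  Subgroup.list_prod_mem _ fun s hs => Subgroup.subset_closure (hl s hs)

theorem inv_word {S : Set W} (hS : ∀ s ∈ S, s * s = 1) (l : List W) (hl : ∀ s ∈ l, s ∈ S) :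
    l.prod⁻¹ = l.reverse.prod := by
  rw [List.prod_inv_reverse]
  congr 1
  conv_rhs => rw [← List.map_id l.reverse]
  rw [← List.map_reverse]
  refine List.map_congr_left fun s hs => ?_
  exact inv_eq_of_mul_eq_one_right (hS s (hl s (List.mem_reverse.1 hs)))

theorem exists_word {S : Set W} (hS : ∀ s ∈ S, s * s = 1) {w : W} (hw : w ∈ Subgroup.closure S) :
    ∃ l : List W, (∀ s ∈ l, s ∈ S) ∧ l.prod = w := by
  induction hw using Subgroup.closure_induction with
  | mem x hx => exact ⟨[x], by simpa using hx, by simp⟩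
  | one => exact ⟨[], by simp, by simp⟩
  | mul x y _ _ hx hy =>
    obtain ⟨l, hl, rfl⟩ := hx
    obtain ⟨l', hl', rfl⟩ := hy
    refine ⟨l ++ l', fun s hs => ?_, by simp⟩
    rcases List.mem_append.1 hs with h | h
    exacts [hl s h, hl' s h]
  | inv x _ hx =>
    obtain ⟨l, hl, rfl⟩ := hx
    exact ⟨l.reverse, fun s hs => hl s (List.mem_reverse.1 hs), (inv_word hS l hl).symm⟩

theorem exists_reduced_word {S : Set W} (hS : ∀ s ∈ S, s * s = 1) {w : W}
    (hw : w ∈ Subgroup.closure S) :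
    ∃ l : List W, (∀ s ∈ l, s ∈ S) ∧ l.prod = w ∧ l.length = wordLen S w := by
  obtain ⟨l, hl, h⟩ := exists_word hS hw
  exact Nat.sInf_mem (s := {m : ℕ | ∃ l : List W, (∀ s ∈ l, s ∈ S) ∧ l.prod = w ∧ l.length = m})
    ⟨l.length, l, hl, h, rfl⟩

@[simp] theorem wordLen_one (S : Set W) : wordLen S (1 : W) = 0 := by
  have := wordLen_le_length (S := S) (l := []) (by simp)
  simpa using this

theorem eq_one_of_wordLen {S : Set W} (hS : ∀ s ∈ S, s * s = 1) {w : W}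
    (hw : w ∈ Subgroup.closure S) (h : wordLen S w = 0) : w = 1 := by
  obtain ⟨l, -, rfl, h'⟩ := exists_reduced_word hS hw
  rw [h, List.length_eq_zero_iff] at h'
  simp [h']

theorem wordLen_mul_le {S : Set W} (hS : ∀ s ∈ S, s * s = 1) {v w : W}
    (hv : v ∈ Subgroup.closure S) (hw : w ∈ Subgroup.closure S) :
    wordLen S (v * w) ≤ wordLen S v + wordLen S w := by
  obtain ⟨l, hl, rfl, h⟩ := exists_reduced_word hS hv
  obtain ⟨l', hl', rfl, h'⟩ := exists_reduced_word hS hw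
  rw [← h, ← h', ← List.length_append, ← List.prod_append]
  refine wordLen_le_length fun s hs => ?_
  rcases List.mem_append.1 hs with h | h
  exacts [hl s h, hl' s h]

theorem wordLen_le_one {S : Set W} {s : W} (hs : s ∈ S) : wordLen S s ≤ 1 := by
  have := wordLen_le_length (S := S) (l := [s]) (by simpa using hs)
  simpa using this

theorem wordLen_inv_le {S : Set W} (hS : ∀ s ∈ S, s * s = 1) {w : W}
    (hw : w ∈ Subgroup.closure S) : wordLen S w⁻¹ ≤ wordLen S w := by
  obtain ⟨l, hl, rfl, h⟩ := exists_reduced_word hS hw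
  rw [inv_word hS l hl, ← h, ← List.length_reverse]
  exact wordLen_le_length fun s hs => hl s (List.mem_reverse.1 hs)

theorem wordLen_inv {S : Set W} (hS : ∀ s ∈ S, s * s = 1) {w : W}
    (hw : w ∈ Subgroup.closure S) : wordLen S w⁻¹ = wordLen S w :=
  le_antisymm (wordLen_inv_le hS hw) (by
    simpa using wordLen_inv_le hS (inv_mem hw))

theorem exists_left_letter {S : Set W} (hS : ∀ s ∈ S, s * s = 1) {w : W}
    (hw : w ∈ Subgroup.closure S) (h1 : w ≠ 1) :
    ∃ s ∈ S, ∃ v ∈ Subgroup.closure S, w = s * v ∧ wordLen S w = wordLen S v + 1 := by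
  obtain ⟨l, hl, rfl, h⟩ := exists_reduced_word hS hw
  cases l with
  | nil => simp at h1
  | cons s l =>
    have hs : s ∈ S := hl s (by simp)
    have hl' : ∀ s ∈ l, s ∈ S := fun t ht => hl t (by simp [ht])
    have hm := prod_mem_closure hl'
    refine ⟨s, hs, l.prod, hm, by simp, ?_⟩
    have h2 := wordLen_le_length hl'
    have h3 := wordLen_mul_le hS (Subgroup.subset_closure hs) hm
    have h4 := wordLen_le_one hs
    simp only [List.prod_cons, List.length_cons] at h ⊢
    omega

theorem exists_right_letter {S : Set W} (hS : ∀ s ∈ S, s * s = 1) {w : W}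
    (hw : w ∈ Subgroup.closure S) (h1 : w ≠ 1) :
    ∃ s ∈ S, ∃ v ∈ Subgroup.closure S, w = v * s ∧ wordLen S w = wordLen S v + 1 := by
  obtain ⟨s, hs, v, hv, h, h'⟩ := exists_left_letter hS (inv_mem hw) (by simpa using h1)
  refine ⟨s, hs, v⁻¹, inv_mem hv, ?_, ?_⟩
  · rw [← inv_inv w, h, mul_inv_rev, inv_eq_of_mul_eq_one_right (hS s hs)]
  · rw [← wordLen_inv hS hw, wordLen_inv hS hv, h']

theorem exists_minimal_factor (S L : Set W) (y : W) : ∃ x ∈ Subgroup.closure L, ∃ y₀, y = x * y₀ ∧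
    ∀ x' ∈ Subgroup.closure L, wordLen S y₀ ≤ wordLen S (x' * y₀) := by
  let f : Subgroup.closure L → ℕ := fun x => wordLen S ((x : W)⁻¹ * y)
  let a : Subgroup.closure L := Function.argmin f
  refine ⟨a, a.2, (a : W)⁻¹ * y, by simp, fun x' hx' => ?_⟩
  have := Function.argmin_le f (a * ⟨x'⁻¹, inv_mem hx'⟩)
  simpa [f, a, mul_assoc] using this

/-! ### Exchange, standard subgroups `W_L` and longest elements. -/

/-- A group with a generating set of involutions satisfying the folding condition. -/
structure IsFolding (S : Set W) : Prop where
  gen : Subgroup.closure S = ⊤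
  sq : ∀ s ∈ S, s * s = 1
  ne : ∀ s ∈ S, ∀ w, wordLen S (s * w) ≠ wordLen S w
  fold : ∀ s ∈ S, ∀ t ∈ S, ∀ w, wordLen S w < wordLen S (s * w) →
    wordLen S w < wordLen S (w * t) → wordLen S (s * w * t) ≤ wordLen S w → s * w = w * t

namespace IsFolding

variable {S : Set W} (h : IsFolding S)

include h

theorem mem (w : W) : w ∈ Subgroup.closure S := h.gen ▸ Subgroup.mem_top w

theorem len_inv (w : W) : wordLen S w⁻¹ = wordLen S w := wordLen_inv h.sq (h.mem w)

theorem len_mul_le (v w : W) : wordLen S (v * w) ≤ wordLen S v + wordLen S w :=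
  wordLen_mul_le h.sq (h.mem v) (h.mem w)

theorem inv_eq {s : W} (hs : s ∈ S) : s⁻¹ = s := inv_eq_of_mul_eq_one_right (h.sq s hs)

theorem mul_mul_cancel {s : W} (hs : s ∈ S) (w : W) : s * (s * w) = w := by
  rw [← mul_assoc, h.sq s hs, one_mul]

theorem mul_mul_cancel_right {s : W} (hs : s ∈ S) (w : W) : w * s * s = w := by
  rw [mul_assoc, h.sq s hs, mul_one]

theorem len_left {s : W} (hs : s ∈ S) (w : W) :
    wordLen S (s * w) = wordLen S w + 1 ∨ wordLen S (s * w) + 1 = wordLen S w := by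
  have h1 := h.len_mul_le s w
  have h2 := h.len_mul_le s (s * w)
  have h3 := h.ne s hs w
  have h4 := wordLen_le_one hs
  rw [h.mul_mul_cancel hs] at h2
  omega

theorem len_right {s : W} (hs : s ∈ S) (w : W) :
    wordLen S (w * s) = wordLen S w + 1 ∨ wordLen S (w * s) + 1 = wordLen S w := by
  have := h.len_left hs w⁻¹
  rwa [← h.len_inv (w * s), mul_inv_rev, h.inv_eq hs, ← h.len_inv w]

theorem len_one {s : W} (hs : s ∈ S) : wordLen S s = 1 := by
  have := h.len_left hs 1
  simpa using this

theorem fold_of_lt {s t : W} (hs : s ∈ S) (ht : t ∈ S) {w : W}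
    (h1 : wordLen S w < wordLen S (s * w)) (h2 : wordLen S (s * w * t) < wordLen S (w * t)) :
    s * w = w * t := by
  have h3 := h.len_right ht w
  have h4 := h.len_right ht (s * w)
  refine h.fold s hs t ht w h1 ?_ ?_ <;> omega

/-- The exchange condition. -/
theorem exchange {L : Set W} (hL : L ⊆ S) {s z : W} (hs : s ∈ S)
    (hz : wordLen S z < wordLen S (s * z)) {b : W} (hb : b ∈ Subgroup.closure L)
    (hlt : wordLen S (s * (z * b)) < wordLen S (z * b)) :
    z⁻¹ * (s * (z * b)) ∈ Subgroup.closure L ∧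
      wordLen L (z⁻¹ * (s * (z * b))) < wordLen L b := by
  have hLq : ∀ s ∈ L, s * s = 1 := fun s hs => h.sq s (hL hs)
  induction hn : wordLen L b generalizing b with
  | zero =>
    rw [eq_one_of_wordLen hLq hb hn, mul_one] at hlt
    omega
  | succ n ih =>
    have hb1 : b ≠ 1 := by rintro rfl; simp at hn
    obtain ⟨r, hr, c, hc, rfl, hc'⟩ := exists_right_letter hLq hb hb1
    -- Either the length drop already occurs for `z c`, or it is caused by the last letter `r`; then
    -- folding gives `s z c = z c r`, so `r` is the letter to delete.
    by_cases hlt' : wordLen S (s * (z * c)) < wordLen S (z * c)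
    · obtain ⟨h1, h2⟩ := ih hc hlt' (by omega)
      have e : z⁻¹ * (s * (z * (c * r))) = z⁻¹ * (s * (z * c)) * r := by group
      rw [e]
      refine ⟨mul_mem h1 (Subgroup.subset_closure hr), ?_⟩
      have h3 := wordLen_mul_le hLq h1 (Subgroup.subset_closure hr)
      have h4 := wordLen_le_one hr
      omega
    · have h1 := h.ne s hs (z * c)
      have h2 := h.fold_of_lt (w := z * c) hs (hL hr) (by omega)
        (by simpa only [mul_assoc] using hlt)
      have e : z⁻¹ * (s * (z * (c * r))) = c := by
        rw [← mul_assoc z, ← mul_assoc s, h2, h.mul_mul_cancel_right (hL hr)]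
        group
      rw [e]
      exact ⟨hc, by omega⟩

/-- If prefixing a letter of `L` raised the `L`-length but lowered the `S`-length, exchange would
delete a letter of an `L`-word. -/
theorem len_eq_of_mem {L : Set W} (hL : L ⊆ S) {x : W} (hx : x ∈ Subgroup.closure L) :
    wordLen L x = wordLen S x := by
  have hLq : ∀ s ∈ L, s * s = 1 := fun s hs => h.sq s (hL hs)
  induction hn : wordLen L x generalizing x with
  | zero => rw [eq_one_of_wordLen hLq hx hn, wordLen_one]
  | succ n ih =>
    have hb1 : x ≠ 1 := by rintro rfl; simp at hn
    obtain ⟨r, hr, c, hc, rfl, hc'⟩ := exists_left_letter hLq hx hb1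
    have h1 := ih hc (by omega)
    have h2 := h.len_left (hL hr) c
    have h3 : ¬ wordLen S (r * c) < wordLen S c := fun hlt => by
      have := (h.exchange hL (z := 1) (hL hr) (by simp [h.len_one (hL hr)]) hc
        (by simpa using hlt)).2
      simp only [one_mul, inv_one] at this
      omega
    omega

theorem len_mul_of_minimal {L : Set W} (hL : L ⊆ S) {y : W}
    (hy : ∀ x ∈ Subgroup.closure L, wordLen S y ≤ wordLen S (x * y)) {x : W}
    (hx : x ∈ Subgroup.closure L) : wordLen S (x * y) = wordLen S x + wordLen S y := by
  have hLq : ∀ s ∈ L, s * s = 1 := fun s hs => h.sq s (hL hs)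
  induction hn : wordLen L x generalizing x with
  | zero => simp [eq_one_of_wordLen hLq hx hn]
  | succ n ih =>
    have hb1 : x ≠ 1 := by rintro rfl; simp at hn
    obtain ⟨r, hr, c, hc, rfl, hc'⟩ := exists_left_letter hLq hx hb1
    have h1 := ih hc (by omega)
    have h2 := h.len_left (hL hr) (c * y)
    have h4 := h.len_eq_of_mem hL hx
    have h5 := h.len_eq_of_mem hL hc
    have h3 : ¬ wordLen S (r * (c * y)) < wordLen S (c * y) := fun hlt => by
      have h6 := (h.exchange subset_rfl (z := c) (hL hr) (by omega) (h.mem y) hlt).2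
      have h7 := hy (c⁻¹ * r * c)
        (mul_mem (mul_mem (inv_mem hc) (Subgroup.subset_closure hr)) hc)
      simp only [mul_assoc] at h6 h7
      omega
    rw [mul_assoc]
    omega

/-- Write `y = z y₀` with `y₀` shortest in `W_L y`. The first letter of a nontrivial `z` would be a
left descent of `y` in `L`. -/
theorem len_mul_of_ascent {L : Set W} (hL : L ⊆ S) {y : W}
    (hy : ∀ t ∈ L, wordLen S y < wordLen S (t * y)) {x : W}
    (hx : x ∈ Subgroup.closure L) : wordLen S (x * y) = wordLen S x + wordLen S y := by
  have hLq : ∀ s ∈ L, s * s = 1 := fun s hs => h.sq s (hL hs)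
  obtain ⟨z, hz, y₀, rfl, hy₀⟩ := exists_minimal_factor S L y
  obtain rfl : z = 1 := by
    by_contra hz1
    obtain ⟨r, hr, c, hc, rfl, hc'⟩ := exists_left_letter hLq hz hz1
    have h1 := hy r hr
    have h2 := h.len_mul_of_minimal hL hy₀ hz
    have h3 := h.len_mul_of_minimal hL hy₀ hc
    rw [h.len_eq_of_mem hL hz, h.len_eq_of_mem hL hc] at hc'
    rw [mul_assoc, h.mul_mul_cancel (hL hr), ← mul_assoc] at h1
    omega
  rw [one_mul]
  exact h.len_mul_of_minimal hL hy₀ hx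

/-- Exchange extends an initial factor `c` of `w` to `r c`: the descent `r` cannot delete a letter
of `c`, so it deletes one of `c⁻¹ w`. Thus every element of `W_K` is an initial factor of a reduced
expression of `w`. -/
theorem len_of_descent {K : Set W} (hK : K ⊆ S) {w : W}
    (hw : ∀ t ∈ K, wordLen S (t * w) < wordLen S w) {z : W}
    (hz : z ∈ Subgroup.closure K) : wordLen S (z⁻¹ * w) + wordLen S z = wordLen S w := by
  have hKq : ∀ s ∈ K, s * s = 1 := fun s hs => h.sq s (hK hs)
  induction hn : wordLen K z generalizing z with
  | zero => simp [eq_one_of_wordLen hKq hz hn]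
  | succ n ih =>
    have hb1 : z ≠ 1 := by rintro rfl; simp at hn
    obtain ⟨r, hr, c, hc, rfl, hc'⟩ := exists_left_letter hKq hz hb1
    have h1 := ih hc (by omega)
    have h4 := h.len_eq_of_mem hK hz
    have h5 := h.len_eq_of_mem hK hc
    have h6 := (h.exchange subset_rfl (z := c) (hK hr) (by omega) (h.mem (c⁻¹ * w))
      (by simpa using hw r hr)).2
    have h7 := h.len_mul_le (r * c) ((r * c)⁻¹ * w)
    rw [mul_inv_cancel_left] at h6 h7
    rw [mul_inv_rev, h.inv_eq (hK hr), mul_assoc] at h7 ⊢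
    omega

theorem len_mul_of_ascent_right {L : Set W} (hL : L ⊆ S) {y : W}
    (hy : ∀ t ∈ L, wordLen S y < wordLen S (y * t)) {x : W}
    (hx : x ∈ Subgroup.closure L) : wordLen S (y * x) = wordLen S y + wordLen S x := by
  have := h.len_mul_of_ascent hL (y := y⁻¹) (fun t ht => by
    have := hy t ht
    rwa [← h.len_inv (y * t), mul_inv_rev, h.inv_eq (hL ht), ← h.len_inv y] at this)
    (inv_mem hx)
  rw [← mul_inv_rev, h.len_inv, h.len_inv, h.len_inv] at this
  omega

theorem len_of_descent_right {K : Set W} (hK : K ⊆ S) {w : W}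
    (hw : ∀ t ∈ K, wordLen S (w * t) < wordLen S w) {z : W}
    (hz : z ∈ Subgroup.closure K) : wordLen S (w * z) + wordLen S z = wordLen S w := by
  have := h.len_of_descent hK (w := w⁻¹) (fun t ht => by
    have := hw t ht
    rwa [← h.len_inv (w * t), mul_inv_rev, h.inv_eq (hK ht), ← h.len_inv w] at this) hz
  rwa [← mul_inv_rev, h.len_inv, h.len_inv] at this

/-- Exchange puts `t` into `W_L`, and an element of length one in `W_L` is a letter of `L`. -/
theorem mem_of_descent {L : Set W} (hL : L ⊆ S) {t b : W} (ht : t ∈ S)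
    (hb : b ∈ Subgroup.closure L) (hlt : wordLen S (t * b) < wordLen S b) : t ∈ L := by
  have hLq : ∀ s ∈ L, s * s = 1 := fun s hs => h.sq s (hL hs)
  have h1 := (h.exchange hL (z := 1) ht (by simp [h.len_one ht]) hb (by simpa using hlt)).1
  simp only [one_mul, inv_one] at h1
  have h2 : t ∈ Subgroup.closure L := by simpa using mul_mem h1 (inv_mem hb)
  have h3 : t ≠ 1 := by rintro rfl; simpa using h.len_one ht
  obtain ⟨r, hr, c, hc, e, hc'⟩ := exists_left_letter hLq h2 h3
  rw [h.len_eq_of_mem hL h2, h.len_one ht] at hc'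
  have hc1 := eq_one_of_wordLen hLq hc (by omega)
  rw [e, hc1, mul_one]
  exact hr

theorem eq_one_of_mem_of_mem {J L : Set W} (hJ : J ⊆ S) (hL : L ⊆ S) (hd : Disjoint J L) {x : W}
    (hxJ : x ∈ Subgroup.closure J) (hxL : x ∈ Subgroup.closure L) : x = 1 := by
  by_contra h1
  obtain ⟨r, hr, c, hc, rfl, hc'⟩ :=
    exists_left_letter (fun s hs => h.sq s (hJ hs)) hxJ h1
  rw [h.len_eq_of_mem hJ hxJ, h.len_eq_of_mem hJ hc] at hc'
  refine Set.disjoint_left.1 hd hr (h.mem_of_descent hL (hJ hr) hxL ?_)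
  rw [h.mul_mul_cancel (hJ hr)]
  omega

/-- Every element of `S` is a letter of a fixed reduced word of `w`, so `S` is finite; and no
element is longer than `w`. -/
theorem finite_of_descent {w : W} (hw : ∀ s ∈ S, wordLen S (s * w) < wordLen S w) :
    Finite W := by
  obtain ⟨l, hl, hlw, -⟩ := exists_reduced_word h.sq (h.mem w)
  have hwl : w ∈ Subgroup.closure {x | x ∈ l} :=
    hlw ▸ prod_mem_closure (S := {x | x ∈ l}) fun _ hs => hs
  have hfin : S.Finite := l.finite_toSet.subset fun s hs =>
    h.mem_of_descent (L := {x | x ∈ l}) hl hs hwl (hw s hs)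
  have : Finite S := hfin
  have h2 : (Set.univ : Set W) ⊆ (fun l : List S => (l.map Subtype.val).prod) ''
      {l | l.length ≤ wordLen S w} := fun v _ => by
    obtain ⟨m, hm, hmv, hm'⟩ := exists_reduced_word h.sq (h.mem v)
    have h3 := h.len_of_descent subset_rfl hw (h.mem v)
    refine ⟨m.attach.map fun x => ⟨x.1, hm _ x.2⟩, ?_, ?_⟩
    · simp; omega
    · simp only [List.map_map]
      simpa [Function.comp_def] using hmv
  exact Set.finite_univ_iff.1 (((List.finite_length_le S _).image _).subset h2)

theorem exists_longest [Finite W] {K : Set W} (hK : K ⊆ S) : ∃ w ∈ Subgroup.closure K,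
    (∀ t ∈ K, wordLen S (t * w) < wordLen S w) ∧ ∀ t ∈ K, wordLen S (w * t) < wordLen S w := by
  obtain ⟨w, hw⟩ := Finite.exists_max fun x : Subgroup.closure K => wordLen S (x : W)
  refine ⟨w, w.2, fun t ht => ?_, fun t ht => ?_⟩
  · have h1 := hw (⟨t, Subgroup.subset_closure ht⟩ * w)
    have h2 := h.len_left (hK ht) (w : W)
    simp only [Subgroup.coe_mul] at h1
    omega
  · have h1 := hw (w * ⟨t, Subgroup.subset_closure ht⟩)
    have h2 := h.len_right (hK ht) (w : W)
    simp only [Subgroup.coe_mul] at h1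
    omega

end IsFolding

end WordLength

/-! ### Bruhat cells and the folding condition for `W`. -/

namespace BNTriple

variable {Γ : Type*} [Group Γ] (D : BNTriple Γ)

/-- The axioms of a split `BN`-pair that do not refer to the Zariski topology. -/
structure IsBNPair (S : Set D.W) : Prop where
  generate : D.B ⊔ D.N = ⊤
  generate_W : Subgroup.closure S = ⊤
  order_two : ∀ s ∈ S, orderOf s = 2
  thick : ∀ m : ↥D.N, D.toW m ∈ S → {x : Γ | ∃ b ∈ D.B, x = m * b * m} ≠ (D.B : Set Γ)
  exchange : ∀ ni m : ↥D.N, D.toW ni ∈ S → ∀ b ∈ D.B,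
    (ni : Γ) * b * m ∈ DoubleCoset.doubleCoset ((ni : Γ) * m) D.B D.B
      ∪ DoubleCoset.doubleCoset (m : Γ) D.B D.B
  U_le_B : D.U ≤ D.B
  normal_U : (D.U.subgroupOf D.B).Normal
  T_inf_U : D.T ⊓ D.U = ⊥
  T_sup_U : D.T ⊔ D.U = D.B
  saturated : ∀ g : Γ, (∀ m ∈ D.N, ∃ b ∈ D.B, g = m * b * m⁻¹) ↔ g ∈ D.T

/-- The Bruhat cell `B w B`. -/
def cell (w : D.W) : Set Γ :=
  {g | ∃ b ∈ D.B, ∃ n : D.N, D.toW n = w ∧ ∃ b' ∈ D.B, g = b * n * b'}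

theorem toW_surjective : Function.Surjective D.toW := QuotientGroup.mk'_surjective _

theorem toW_eq_one {n : D.N} : D.toW n = 1 ↔ (n : Γ) ∈ D.B := by
  rw [toW, QuotientGroup.mk'_apply, QuotientGroup.eq_one_iff, Subgroup.mem_subgroupOf, T,
    Subgroup.mem_inf]
  exact ⟨fun h => h.1, fun h => ⟨h, n.2⟩⟩

variable {D}

theorem mem_cell_toW (n : D.N) : (n : Γ) ∈ D.cell (D.toW n) :=
  ⟨1, one_mem _, n, rfl, 1, one_mem _, by simp⟩

theorem mem_cell_one {g : Γ} : g ∈ D.cell 1 ↔ g ∈ D.B := by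
  constructor
  · rintro ⟨b, hb, n, hn, b', hb', rfl⟩
    exact mul_mem (mul_mem hb (D.toW_eq_one.1 hn)) hb'
  · intro hg
    exact ⟨g, hg, 1, map_one _, 1, one_mem _, by simp⟩

theorem mul_mem_cell {w : D.W} {b g : Γ} (hb : b ∈ D.B) (hg : g ∈ D.cell w) :
    b * g ∈ D.cell w := by
  obtain ⟨c, hc, n, hn, c', hc', rfl⟩ := hg
  exact ⟨b * c, mul_mem hb hc, n, hn, c', hc', by simp [mul_assoc]⟩

theorem mem_cell_mul {w : D.W} {b g : Γ} (hg : g ∈ D.cell w) (hb : b ∈ D.B) :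
    g * b ∈ D.cell w := by
  obtain ⟨c, hc, n, hn, c', hc', rfl⟩ := hg
  exact ⟨c, hc, n, hn, c' * b, mul_mem hc' hb, by simp [mul_assoc]⟩

theorem inv_mem_cell {w : D.W} {g : Γ} (hg : g ∈ D.cell w) : g⁻¹ ∈ D.cell w⁻¹ := by
  obtain ⟨c, hc, n, rfl, c', hc', rfl⟩ := hg
  exact ⟨c'⁻¹, inv_mem hc', n⁻¹, map_inv _ _, c⁻¹, inv_mem hc, by simp [mul_assoc]⟩

theorem exists_eq_of_mem_cell {n : D.N} {g : Γ} (hg : g ∈ D.cell (D.toW n)) :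
    ∃ b ∈ D.B, ∃ b' ∈ D.B, g = b * n * b' := by
  obtain ⟨c, hc, m, hm, c', hc', rfl⟩ := hg
  have h1 : D.toW (n⁻¹ * m) = 1 := by rw [map_mul, map_inv, hm, inv_mul_cancel]
  rw [toW_eq_one] at h1
  exact ⟨c, hc, _, mul_mem h1 hc', by simp [mul_assoc]⟩

theorem exists_eq_of_mem_cell' {w : D.W} {g h : Γ} (hg : g ∈ D.cell w) (hh : h ∈ D.cell w) :
    ∃ b ∈ D.B, ∃ b' ∈ D.B, h = b * g * b' := by
  obtain ⟨n, rfl⟩ := D.toW_surjective w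
  obtain ⟨b, hb, b', hb', rfl⟩ := exists_eq_of_mem_cell hg
  obtain ⟨c, hc, c', hc', rfl⟩ := exists_eq_of_mem_cell hh
  exact ⟨c * b⁻¹, mul_mem hc (inv_mem hb), b'⁻¹ * c', mul_mem (inv_mem hb') hc',
    by simp [mul_assoc]⟩

theorem cell_split {v w : D.W} {g : Γ} (hg : g ∈ D.cell (v * w)) :
    ∃ g₁ ∈ D.cell v, ∃ g₂ ∈ D.cell w, g = g₁ * g₂ := by
  obtain ⟨n, rfl⟩ := D.toW_surjective v
  obtain ⟨m, rfl⟩ := D.toW_surjective w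
  rw [← map_mul] at hg
  obtain ⟨b, hb, b', hb', rfl⟩ := exists_eq_of_mem_cell hg
  exact ⟨b * n, mul_mem_cell hb (mem_cell_toW n), m * b', mem_cell_mul (mem_cell_toW m) hb',
    by simp [mul_assoc]⟩

namespace IsBNPair

variable {S : Set D.W} (hD : D.IsBNPair S)

include hD

theorem sq (s : D.W) (hs : s ∈ S) : s * s = 1 := by
  rw [← _root_.sq, ← hD.order_two s hs, pow_orderOf_eq_one]

theorem ne_one {s : D.W} (hs : s ∈ S) : s ≠ 1 := by
  rintro rfl
  simpa using hD.order_two 1 hs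

theorem inv_eq {s : D.W} (hs : s ∈ S) : s⁻¹ = s := inv_eq_of_mul_eq_one_right (hD.sq s hs)

theorem mem_closure (w : D.W) : w ∈ Subgroup.closure S := hD.generate_W ▸ Subgroup.mem_top w

theorem mul_cell {s w : D.W} (hs : s ∈ S) {g h : Γ} (hg : g ∈ D.cell s) (hh : h ∈ D.cell w) :
    g * h ∈ D.cell (s * w) ∨ g * h ∈ D.cell w := by
  obtain ⟨b, hb, n, rfl, b', hb', rfl⟩ := hg
  obtain ⟨c, hc, m, rfl, c', hc', rfl⟩ := hh
  have e : b * n * b' * (c * m * c') = b * (n * (b' * c) * m) * c' := by simp [mul_assoc]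
  rw [e]
  rcases hD.exchange n m hs _ (mul_mem hb' hc) with h | h
  · left
    obtain ⟨x, hx, y, hy, h⟩ := DoubleCoset.mem_doubleCoset.1 h
    rw [h]
    refine mem_cell_mul (mul_mem_cell hb (mem_cell_mul (mul_mem_cell hx ?_) hy)) hc'
    rw [← map_mul]
    exact mem_cell_toW (n * m)
  · right
    obtain ⟨x, hx, y, hy, h⟩ := DoubleCoset.mem_doubleCoset.1 h
    rw [h]
    exact mem_cell_mul (mul_mem_cell hb (mem_cell_mul (mul_mem_cell hx (mem_cell_toW m)) hy)) hc'

theorem cell_mul {s w : D.W} (hs : s ∈ S) {g h : Γ} (hg : g ∈ D.cell s) (hh : h ∈ D.cell w) :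
    h * g ∈ D.cell (w * s) ∨ h * g ∈ D.cell w := by
  have h1 := inv_mem_cell hg
  rw [hD.inv_eq hs] at h1
  rcases hD.mul_cell hs h1 (inv_mem_cell hh) with h | h
  · left
    simpa [hD.inv_eq hs] using inv_mem_cell h
  · right
    simpa using inv_mem_cell h

theorem mul_cell_closure {L : Set D.W} (hL : L ⊆ S) {x w : D.W} (hx : x ∈ Subgroup.closure L)
    {g h : Γ} (hg : g ∈ D.cell x) (hh : h ∈ D.cell w) :
    ∃ x' ∈ Subgroup.closure L, g * h ∈ D.cell (x' * w) := by
  obtain ⟨l, hl, rfl⟩ := exists_word (fun s hs => hD.sq s (hL hs)) hx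
  clear hx
  induction l generalizing g with
  | nil => exact ⟨1, one_mem _, by simpa using mul_mem_cell (mem_cell_one.1 hg) hh⟩
  | cons s l ih =>
    have hs : s ∈ L := hl s (by simp)
    rw [List.prod_cons] at hg
    obtain ⟨g₁, hg₁, g₂, hg₂, rfl⟩ := cell_split hg
    obtain ⟨x', hx', h'⟩ := ih (fun t ht => hl t (by simp [ht])) hg₂
    rw [mul_assoc]
    rcases hD.mul_cell (hL hs) hg₁ h' with h | h
    · exact ⟨s * x', mul_mem (Subgroup.subset_closure hs) hx', by rwa [mul_assoc]⟩
    · exact ⟨x', hx', h⟩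

theorem exists_mem_cell (g : Γ) : ∃ w, g ∈ D.cell w := by
  suffices H : ∀ h : Γ, h ∈ Subgroup.closure ((D.B : Set Γ) ∪ D.N) →
      ∀ w, ∀ g ∈ D.cell w, (∃ w', h * g ∈ D.cell w') ∧ ∃ w', h⁻¹ * g ∈ D.cell w' by
    have h1 : g ∈ Subgroup.closure ((D.B : Set Γ) ∪ D.N) := by
      rw [Subgroup.closure_union, Subgroup.closure_eq, Subgroup.closure_eq, hD.generate]
      exact Subgroup.mem_top g
    simpa using (H g h1 1 1 (mem_cell_one.2 (one_mem _))).1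
  intro h hh
  induction hh using Subgroup.closure_induction with
  | mem x hx =>
    intro w g hg
    rcases hx with hx | hx
    · exact ⟨⟨w, mul_mem_cell hx hg⟩, ⟨w, mul_mem_cell (inv_mem hx) hg⟩⟩
    · have h1 := mem_cell_toW ⟨x, hx⟩
      obtain ⟨x', -, h2⟩ := hD.mul_cell_closure subset_rfl (hD.mem_closure _) h1 hg
      obtain ⟨x'', -, h3⟩ := hD.mul_cell_closure subset_rfl (hD.mem_closure _) (inv_mem_cell h1) hg
      exact ⟨⟨_, h2⟩, ⟨_, h3⟩⟩
  | one => exact fun w g hg => ⟨⟨w, by simpa using hg⟩, ⟨w, by simpa using hg⟩⟩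
  | mul x y _ _ hx hy =>
    intro w g hg
    obtain ⟨w₁, h₁⟩ := (hy w g hg).1
    obtain ⟨w₂, h₂⟩ := (hx w₁ _ h₁).1
    obtain ⟨w₃, h₃⟩ := (hx w g hg).2
    obtain ⟨w₄, h₄⟩ := (hy w₃ _ h₃).2
    exact ⟨⟨w₂, by rwa [mul_assoc]⟩, ⟨w₄, by rwa [mul_inv_rev, mul_assoc]⟩⟩
  | inv x _ hx =>
    intro w g hg
    rw [inv_inv]
    exact (hx w g hg).symm

/-- Disjointness of cells, by induction on the smaller length: strip the first letter of `w` from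
`g` and compare the cells of what remains. -/
theorem cell_unique_aux (n : ℕ) : ∀ (g : Γ) (w w' : D.W), wordLen S w = n →
    wordLen S w ≤ wordLen S w' → g ∈ D.cell w → g ∈ D.cell w' → w = w' := by
  induction n with
  | zero =>
    intro g w w' hw _ hg hg'
    obtain rfl := eq_one_of_wordLen hD.sq (hD.mem_closure w) hw
    obtain ⟨b, hb, m, rfl, b', hb', rfl⟩ := hg'
    rw [mem_cell_one] at hg
    rw [eq_comm, toW_eq_one]
    simpa [mul_assoc] using mul_mem (mul_mem (inv_mem hb) hg) (inv_mem hb')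
  | succ n ih =>
    intro g w w' hw hle hg hg'
    have h1 : w ≠ 1 := by rintro rfl; simp at hw
    obtain ⟨s, hs, v, hv, rfl, hv'⟩ := exists_left_letter hD.sq (hD.mem_closure w) h1
    obtain ⟨g₁, hg₁, g₂, hg₂, rfl⟩ := cell_split hg
    have h2 := inv_mem_cell hg₁
    rw [hD.inv_eq hs] at h2
    have h3 := wordLen_mul_le hD.sq (hD.mem_closure s) (hD.mem_closure (s * w'))
    have h4 := wordLen_le_one hs
    rw [← mul_assoc, hD.sq s hs, one_mul] at h3
    have h5 := hD.mul_cell hs h2 hg'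
    rw [inv_mul_cancel_left] at h5
    rcases h5 with h5 | h5
    · rw [ih g₂ v (s * w') (by omega) (by omega) hg₂ h5, ← mul_assoc, hD.sq s hs, one_mul]
    · have := ih g₂ v w' (by omega) (by omega) hg₂ h5
      subst this
      omega

theorem cell_unique {g : Γ} {w w' : D.W} (hg : g ∈ D.cell w) (hg' : g ∈ D.cell w') : w = w' := by
  rcases le_total (wordLen S w) (wordLen S w') with h | h
  · exact hD.cell_unique_aux _ g w w' rfl h hg hg'
  · exact (hD.cell_unique_aux _ g w' w rfl h hg' hg).symm

/-- The inequality is weak on purpose: that `s w` and `w` never have equal length is deduced from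
this lemma in `isFolding`. -/
theorem mul_cell_of_le {s : D.W} (hs : s ∈ S) (n : ℕ) : ∀ (w : D.W), wordLen S w = n →
    wordLen S w ≤ wordLen S (s * w) → ∀ g ∈ D.cell s, ∀ h ∈ D.cell w, g * h ∈ D.cell (s * w) := by
  induction n with
  | zero =>
    intro w hw _ g hg h hh
    obtain rfl := eq_one_of_wordLen hD.sq (hD.mem_closure w) hw
    rw [mul_one]
    exact mem_cell_mul hg (mem_cell_one.1 hh)
  | succ n ih =>
    intro w hw hle g hg h hh
    have h1 : w ≠ 1 := by rintro rfl; simp at hw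
    refine (hD.mul_cell hs hg hh).resolve_right fun h2 => ?_
    obtain ⟨t, ht, v, hv, rfl, hv'⟩ := exists_right_letter hD.sq (hD.mem_closure w) h1
    obtain ⟨h₁, hh₁, p, hp, rfl⟩ := cell_split hh
    have h3 := wordLen_mul_le hD.sq (hD.mem_closure (s * v)) (hD.mem_closure t)
    have h4 := wordLen_le_one ht
    rw [mul_assoc] at h3
    have h5 := ih v (by omega) (by omega) g hg h₁ hh₁
    have h6 := inv_mem_cell hp
    rw [hD.inv_eq ht] at h6
    -- Undoing the letter `t` gives a second cell for `g h₁`. Then `s v = v` is absurd, and `s v = v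
    -- t` means `s w = v`, shorter than `w`.
    have h7 := hD.cell_mul ht h6 h2
    rw [show g * (h₁ * p) * p⁻¹ = g * h₁ by group, mul_assoc v, hD.sq t ht, mul_one] at h7
    rcases h7 with h7 | h7
    · exact hD.ne_one hs (mul_eq_right.1 (hD.cell_unique h5 h7))
    · have h8 := hD.cell_unique h5 h7
      rw [← h8, ← mul_assoc, hD.sq s hs, one_mul] at hle
      rw [← h8] at hw
      rw [h8] at hw hle
      omega

theorem cell_mul_of_le {t : D.W} (ht : t ∈ S) {w : D.W} (hle : wordLen S w ≤ wordLen S (w * t))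
    {g h : Γ} (hg : g ∈ D.cell w) (hh : h ∈ D.cell t) : g * h ∈ D.cell (w * t) := by
  have h1 := wordLen_inv hD.sq (hD.mem_closure w)
  have h2 := wordLen_inv hD.sq (hD.mem_closure (w * t))
  rw [mul_inv_rev, hD.inv_eq ht] at h2
  have h3 := inv_mem_cell (hD.mul_cell_of_le ht _ w⁻¹ rfl (by omega) _
    (hD.inv_eq ht ▸ inv_mem_cell hh) _ (inv_mem_cell hg))
  simpa [hD.inv_eq ht] using h3

theorem exists_thick (n : D.N) (hn : D.toW n ∈ S) : ∃ b ∈ D.B, (n : Γ) * b * n ∉ D.B := by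
  by_contra! H
  refine hD.thick n hn (Set.Subset.antisymm ?_ fun b hb => ?_)
  · rintro _ ⟨b, hb, rfl⟩
    exact H b hb
  · have h1 : (n : Γ) * n ∈ D.B := by
      have := D.toW_eq_one (n := n * n)
      rw [map_mul, hD.sq _ hn] at this
      exact this.1 rfl
    -- As `n² ∈ B`, the inclusion `n B n ⊆ B` already implies equality.
    refine ⟨(n * n : Γ)⁻¹ * (n * b * n) * (n * n : Γ)⁻¹,
      mul_mem (mul_mem (inv_mem h1) (H b hb)) (inv_mem h1), by group⟩

/-- Thickness supplies `n b n ∈ B s B`; a product containing it is evaluated in two bracketings, and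
disjointness of cells compares the results. -/
theorem isFolding : IsFolding S where
  gen := hD.generate_W
  sq := hD.sq
  ne s hs w hlen := by
    obtain ⟨n, rfl⟩ := D.toW_surjective s
    obtain ⟨m, rfl⟩ := D.toW_surjective w
    obtain ⟨b, hb, h1⟩ := hD.exists_thick n hs
    have h2 : (n : Γ) * (b * n) ∈ D.cell (D.toW n) := by
      refine (hD.mul_cell hs (mem_cell_toW n) (mul_mem_cell hb (mem_cell_toW n))).resolve_left ?_
      rwa [hD.sq _ hs, mem_cell_one, ← mul_assoc]
    -- With equal lengths `mul_cell_of_le` applies both to `w` and to `s w`, which puts `n b n m`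
    -- into `B s w B` and into `B w B`.
    have h3 := hD.mul_cell_of_le hs _ (D.toW m) rfl hlen.ge _ h2 _ (mem_cell_toW m)
    have h4 := hD.mul_cell_of_le hs _ (D.toW m) rfl hlen.ge _
      (mul_mem_cell hb (mem_cell_toW n)) _ (mem_cell_toW m)
    have h5 := hD.mul_cell_of_le hs _ _ rfl
      (by rw [← mul_assoc, hD.sq _ hs, one_mul, hlen]) _ (mem_cell_toW n) _ h4
    rw [← mul_assoc (D.toW n), hD.sq _ hs, one_mul, ← mul_assoc] at h5
    exact hD.ne_one hs (mul_eq_right.1 (hD.cell_unique h3 h5))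
  fold s hs t ht w h1 h2 h3 := by
    obtain ⟨n, rfl⟩ := D.toW_surjective s
    obtain ⟨m, rfl⟩ := D.toW_surjective t
    obtain ⟨x, rfl⟩ := D.toW_surjective w
    obtain ⟨b, hb, h4⟩ := hD.exists_thick m ht
    have h5 : (m : Γ) * (b * m) ∈ D.cell (D.toW m) := by
      refine (hD.mul_cell ht (mem_cell_toW m) (mul_mem_cell hb (mem_cell_toW m))).resolve_left ?_
      rwa [hD.sq _ ht, mem_cell_one, ← mul_assoc]
    have h0 := wordLen_mul_le hD.sq (hD.mem_closure (D.toW n * D.toW x * D.toW m))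
      (hD.mem_closure (D.toW m))
    have h0' := wordLen_le_one ht
    rw [mul_assoc _ (D.toW m), hD.sq _ ht, mul_one] at h0
    have hv : wordLen S (D.toW n * D.toW x * D.toW m) ≤ wordLen S (D.toW n * D.toW x) := by omega
    -- the element `n x m b m` lies both in `B s w B` and in `B s w t B ∪ B w t B`
    have hnx : (n : Γ) * x * m ∈ D.cell (D.toW n * D.toW x * D.toW m) := by
      simpa using mem_cell_toW (n * x * m)
    have h7 := hD.cell_mul_of_le ht (w := D.toW n * D.toW x * D.toW m)
      (by rwa [mul_assoc _ (D.toW m), hD.sq _ ht, mul_one]) hnx (mul_mem_cell hb (mem_cell_toW m))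
    rw [mul_assoc _ (D.toW m), hD.sq _ ht, mul_one] at h7
    have h8 := hD.cell_mul_of_le ht h2.le (mem_cell_toW x) h5
    have h10 := hD.mul_cell hs (mem_cell_toW n) h8
    rw [show (n : Γ) * (x * (m * (b * m))) = n * x * m * (b * m) by group] at h10
    rcases h10 with h10 | h10
    · have := hD.cell_unique h7 h10
      rw [← mul_assoc] at this
      exact absurd (mul_eq_left.1 this.symm) (hD.ne_one ht)
    · exact hD.cell_unique h7 h10

end IsBNPair

end BNTriple

/-! ### Commensurability under a descending chain condition. -/

/-- A class of subgroups, stable under conjugation and intersection, with the descending chain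
condition. -/
structure IsNoetherianClass {Γ : Type*} [Group Γ] (C : Subgroup Γ → Prop) : Prop where
  conj : ∀ H, C H → ∀ g : Γ, C (H.comap (MulAut.conj g).toMonoidHom)
  inf : ∀ H K, C H → C K → C (H ⊓ K)
  wf : WellFounded fun H K : {H : Subgroup Γ // C H} => H < K

section Commensurability

variable {Γ : Type*} [Group Γ]

theorem relIndex_comap_conj (H K : Subgroup Γ) (g : Γ) :
    (H.comap (MulAut.conj g).toMonoidHom).relIndex (K.comap (MulAut.conj g).toMonoidHom) =
      H.relIndex K := by
  rw [Subgroup.relIndex_comap, Subgroup.map_comap_eq_self_of_surjective]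
  exact (MulAut.conj g).surjective

theorem comap_conj_comap_conj (H : Subgroup Γ) (g h : Γ) :
    (H.comap (MulAut.conj g).toMonoidHom).comap (MulAut.conj h).toMonoidHom =
      H.comap (MulAut.conj (g * h)).toMonoidHom := by
  ext x
  simp [mul_assoc]

theorem comap_conj_one (H : Subgroup Γ) : H.comap (MulAut.conj (1 : Γ)).toMonoidHom = H := by
  ext x
  simp

/-- The partial intersections of the conjugates of `H` by powers of `x` become stationary, so one of
them lies in the next conjugate. It has finite index in its own last conjugate, and conjugating back
gives the claim. -/
theorem IsNoetherianClass.relIndex_comap_conj_ne_zero {C : Subgroup Γ → Prop}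
    (hC : IsNoetherianClass C) {H : Subgroup Γ} (hH : C H) (x : Γ)
    (h : H.relIndex (H.comap (MulAut.conj x).toMonoidHom) ≠ 0) :
    (H.comap (MulAut.conj x).toMonoidHom).relIndex H ≠ 0 := by
  let A : ℕ → Subgroup Γ := fun n => H.comap (MulAut.conj (x ^ n)).toMonoidHom
  have hA : ∀ n, C (A n) := fun n => hC.conj H hH _
  have hA' : ∀ n, (A n).comap (MulAut.conj x).toMonoidHom = A (n + 1) := fun n => by
    simp only [A, comap_conj_comap_conj, pow_succ]
  have hA1 : ∀ n, (H.comap (MulAut.conj x).toMonoidHom).comap (MulAut.conj (x ^ n)).toMonoidHom =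
      A (n + 1) := fun n => by
    simp only [A, comap_conj_comap_conj, pow_succ']
  have hstep : ∀ n, (A n).relIndex (A (n + 1)) ≠ 0 := fun n => by
    rw [← hA1, relIndex_comap_conj]
    exact h
  -- `E n` is `A 0 ⊓ ⋯ ⊓ A n`.
  let E : ℕ → {H : Subgroup Γ // C H} := fun n =>
    Nat.rec ⟨A 0, hA 0⟩ (fun n K => ⟨K.1 ⊓ A (n + 1), hC.inf _ _ K.2 (hA _)⟩) n
  have hE : ∀ n, (E n).1.relIndex (A n) ≠ 0 := by
    intro n
    induction n with
    | zero => simp [E]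
    | succ n ih =>
      refine Subgroup.relIndex_inf_ne_zero (Subgroup.relIndex_ne_zero_trans ih (hstep n)) ?_
      simp
  obtain ⟨_, ⟨m, rfl⟩, hm⟩ := hC.wf.has_min (Set.range E) ⟨_, 0, rfl⟩
  have h1 : (E m).1 ≤ A (m + 1) := by
    have h2 : E (m + 1) ≤ E m := inf_le_left (a := (E m).1)
    have h3 : E (m + 1) = E m := by
      by_contra h4
      exact hm _ ⟨m + 1, rfl⟩ (lt_of_le_of_ne h2 h4)
    rw [← h3]
    exact inf_le_right (a := (E m).1)
  have h2 : (A (m + 1)).relIndex (A m) ≠ 0 := fun h0 =>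
    hE m (Subgroup.relIndex_eq_zero_of_le_left h1 h0)
  rwa [← hA1, relIndex_comap_conj] at h2

end Commensurability

/-! ### Galleries, chamber stabilizers and the groups `U_s`. -/

namespace BNTriple

variable {Γ : Type*} [Group Γ] {D : BNTriple Γ}

/-- The stabilizer of the chamber `gB`. -/
def stab (D : BNTriple Γ) (g : Γ) : Subgroup Γ := D.B.comap (MulAut.conj g⁻¹).toMonoidHom

theorem mem_stab {g x : Γ} : x ∈ D.stab g ↔ g⁻¹ * x * g ∈ D.B := by
  simp [stab]

theorem mem_stab_of_inv_mul_mem {g h x : Γ} (hg : g⁻¹ * h ∈ D.B) : x ∈ D.stab g ↔ x ∈ D.stab h := by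
  rw [mem_stab, mem_stab]
  constructor
  · intro hx
    simpa [mul_assoc] using mul_mem (mul_mem (inv_mem hg) hx) hg
  · intro hx
    simpa [mul_assoc] using mul_mem (mul_mem hg hx) (inv_mem hg)

theorem mem_stab_mul {g h x : Γ} : x ∈ D.stab (g * h) ↔ g⁻¹ * x * g ∈ D.stab h := by
  simp [mem_stab, mul_assoc]

theorem conj_mem_T {n : D.N} {t : Γ} (ht : t ∈ D.T) : (n : Γ) * t * (n : Γ)⁻¹ ∈ D.T := by
  have := D.normal_T.conj_mem ⟨t, ht.2⟩ ht n
  exact this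

namespace IsBNPair

variable {S : Set D.W} (hD : D.IsBNPair S)

include hD

theorem mul_cell_add {v w : D.W} (hvw : wordLen S (v * w) = wordLen S v + wordLen S w)
    {g h : Γ} (hg : g ∈ D.cell v) (hh : h ∈ D.cell w) : g * h ∈ D.cell (v * w) := by
  have hF := hD.isFolding
  induction hn : wordLen S v generalizing v g with
  | zero =>
    obtain rfl := eq_one_of_wordLen hD.sq (hD.mem_closure v) hn
    rw [one_mul]
    exact mul_mem_cell (mem_cell_one.1 hg) hh
  | succ n ih =>
    have h1 : v ≠ 1 := by rintro rfl; simp at hn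
    obtain ⟨s, hs, v, -, rfl, hv⟩ := exists_left_letter hD.sq (hD.mem_closure v) h1
    obtain ⟨g₁, hg₁, g₂, hg₂, rfl⟩ := cell_split hg
    have h2 := hF.len_mul_le v w
    have h3 := hF.len_left hs (v * w)
    rw [mul_assoc] at hvw ⊢
    rw [mul_assoc]
    exact hD.mul_cell_of_le hs _ _ rfl (by omega) _ hg₁ _ (ih (by omega) hg₂ (by omega))

/-- A minimal gallery is determined by its type and its end chambers. -/
theorem gallery_unique {v w : D.W} (hvw : wordLen S (v * w) = wordLen S v + wordLen S w)
    {g g' h h' : Γ} (hg : g ∈ D.cell v) (hg' : g' ∈ D.cell v) (hh : h ∈ D.cell w)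
    (hh' : h' ∈ D.cell w) (e : g * h = g' * h') : g⁻¹ * g' ∈ D.B := by
  have hF := hD.isFolding
  induction hn : wordLen S w generalizing w h h' with
  | zero =>
    obtain rfl := eq_one_of_wordLen hD.sq (hD.mem_closure w) hn
    rw [mem_cell_one] at hh hh'
    have : g⁻¹ * g' = h * h'⁻¹ := by
      rw [inv_mul_eq_iff_eq_mul, ← mul_assoc, e]; group
    rw [this]
    exact mul_mem hh (inv_mem hh')
  | succ n ih =>
    have h1 : w ≠ 1 := by rintro rfl; simp at hn
    obtain ⟨s, hs, w, -, rfl, hw⟩ := exists_right_letter hD.sq (hD.mem_closure w) h1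
    obtain ⟨k, hk, p, hp, rfl⟩ := cell_split hh
    obtain ⟨k', hk', p', hp', rfl⟩ := cell_split hh'
    have h2 := hF.len_mul_le v w
    have h3 := hF.len_right hs (v * w)
    rw [← mul_assoc] at hvw
    have h4 : wordLen S (v * w) = wordLen S v + wordLen S w := by omega
    have h5 := hD.mul_cell_add h4 hg hk
    have h6 := hD.mul_cell_add h4 hg' hk'
    have h7 : (g * k)⁻¹ * (g' * k') = p * p'⁻¹ := by
      rw [inv_mul_eq_iff_eq_mul, ← mul_assoc, eq_mul_inv_iff_mul_eq, mul_assoc, mul_assoc, e]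
    have h8 : p * p'⁻¹ ∈ D.B := by
      have h9 := inv_mem_cell hp'
      rw [hD.inv_eq hs] at h9
      rcases hD.mul_cell hs hp h9 with h10 | h10
      · rwa [hD.sq s hs, mem_cell_one] at h10
      -- Otherwise `g k B` and `g' k' B` are distinct `s`-adjacent chambers, and one more step of
      -- type `s` puts `g' k'` into the cell of `v w s` instead of `v w`.
      · exfalso
        have h11 := hD.cell_mul_of_le hs (w := v * w) (by omega) h5 h10
        rw [← h7, mul_inv_cancel_left] at h11
        exact hD.ne_one hs (mul_eq_left.1 (hD.cell_unique h11 h6))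
    refine ih h4 (mem_cell_mul hk h8) hk' ?_ (by omega)
    rw [← h7]
    group

/-- `x` carries a minimal gallery from `B` through `gB` to `ghB` to one of the same type with the
same ends, so uniqueness applies. -/
theorem mem_stab_of_mem_stab_mul {v w : D.W}
    (hvw : wordLen S (v * w) = wordLen S v + wordLen S w) {g h x : Γ} (hg : g ∈ D.cell v)
    (hh : h ∈ D.cell w) (hx : x ∈ D.B) (hx' : x ∈ D.stab (g * h)) : x ∈ D.stab g := by
  rw [mem_stab] at hx' ⊢
  have := hD.gallery_unique hvw hg (mul_mem_cell hx hg) (mem_cell_mul hh hx') hh (by group)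
  rwa [← mul_assoc] at this

/-- `B` is transitive on the chambers of one cell; uniqueness of galleries makes the transporting
element fix the intermediate chamber `gB`. -/
theorem exists_stab_transitive {v w : D.W}
    (hvw : wordLen S (v * w) = wordLen S v + wordLen S w) {g h h' : Γ} (hg : g ∈ D.cell v)
    (hh : h ∈ D.cell w) (hh' : h' ∈ D.cell w) :
    ∃ b ∈ D.B, b ∈ D.stab g ∧ (g * h')⁻¹ * (b * (g * h)) ∈ D.B := by
  obtain ⟨b, hb, b', hb', e⟩ := exists_eq_of_mem_cell' (hD.mul_cell_add hvw hg hh)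
    (hD.mul_cell_add hvw hg hh')
  refine ⟨b, hb, ?_, ?_⟩
  · have := hD.gallery_unique hvw hg (mul_mem_cell hb hg) hh' (mem_cell_mul hh hb')
      (by rw [e]; group)
    rwa [mem_stab, mul_assoc]
  · rw [e]
    simpa [mul_assoc] using inv_mem hb'

/-- By thickness there are two different chambers beyond `gB` in its `s`-panel; an element fixing
`B` and `gB` moves one to the other. -/
theorem exists_mem_stab_notMem {v s : D.W} (hs : s ∈ S) (hvs : wordLen S v < wordLen S (v * s))
    {g n : Γ} (hg : g ∈ D.cell v) (hn : n ∈ D.cell s) :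
    ∃ b ∈ D.B, b ∈ D.stab g ∧ b ∉ D.stab (g * n) := by
  have hF := hD.isFolding
  have hvw : wordLen S (v * s) = wordLen S v + wordLen S s := by
    have := hF.len_right hs v
    rw [hF.len_one hs]
    omega
  obtain ⟨m, rfl⟩ := D.toW_surjective s
  obtain ⟨c, hc, h1⟩ := hD.exists_thick m hs
  obtain ⟨b₁, hb₁, b₂, hb₂, rfl⟩ := exists_eq_of_mem_cell hn
  have hm : (m : Γ) * m ∈ D.B := by
    have := D.toW_eq_one (n := m * m)
    rw [map_mul, hD.sq _ hs] at this
    exact this.1 rfl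
  obtain ⟨b, hb, hbg, h2⟩ := hD.exists_stab_transitive hvw hg hn
    (mul_mem_cell (mul_mem hb₁ hc) (mem_cell_toW m))
  refine ⟨b, hb, hbg, fun h3 => h1 ?_⟩
  rw [mem_stab] at h3
  have h4 := mul_mem h2 (inv_mem h3)
  have h5 : (g * (b₁ * c * m))⁻¹ * (b * (g * (b₁ * m * b₂))) *
      ((g * (b₁ * m * b₂))⁻¹ * b * (g * (b₁ * m * b₂)))⁻¹ =
      (m : Γ)⁻¹ * c⁻¹ * m * b₂ := by group
  rw [h5] at h4
  have h6 := mul_mem hb₂ (inv_mem h4)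
  have h7 : b₂ * ((m : Γ)⁻¹ * c⁻¹ * m * b₂)⁻¹ = (m * m : Γ)⁻¹ * (m * c * m) := by group
  rw [h7] at h6
  simpa only [mul_inv_cancel_left] using mul_mem hm h6

/-- Choose `m` with `B ⊓ D.stab m` minimal. A right ascent `s` of `m` would give a strictly smaller
stabilizer, so every `s` is a descent. -/
theorem finite_W {C : Subgroup Γ → Prop} (hC : IsNoetherianClass C) (hB : C D.B) : Finite D.W := by
  have hF := hD.isFolding
  have hcl : ∀ g, C (D.B ⊓ D.stab g) := fun g => hC.inf _ _ hB (hC.conj _ hB _)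
  let E : D.N → {H : Subgroup Γ // C H} := fun n => ⟨_, hcl n⟩
  obtain ⟨_, ⟨m, rfl⟩, hm⟩ := hC.wf.has_min (Set.range E) ⟨_, 1, rfl⟩
  refine hF.finite_of_descent (w := (D.toW m)⁻¹) fun s hs => ?_
  by_contra h1
  have h2 : wordLen S (D.toW m) < wordLen S (D.toW m * s) := by
    rw [← hF.len_inv (D.toW m * s), mul_inv_rev, hD.inv_eq hs, ← hF.len_inv (D.toW m)]
    have := hF.ne s hs (D.toW m)⁻¹
    omega
  obtain ⟨n, rfl⟩ := D.toW_surjective s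
  obtain ⟨b, hb, hb1, hb2⟩ := hD.exists_mem_stab_notMem hs h2 (mem_cell_toW m) (mem_cell_toW n)
  refine hm (E (m * n)) ⟨_, rfl⟩ (lt_of_le_of_ne ?_ fun h3 => ?_)
  · intro x hx
    refine ⟨hx.1, hD.mem_stab_of_mem_stab_mul ?_ (mem_cell_toW m) (mem_cell_toW n) hx.1 hx.2⟩
    have := hF.len_right hs (D.toW m)
    rw [hF.len_one hs]
    omega
  · have h4 : b ∈ (E (m * n)).1 := by
      rw [h3]
      exact ⟨hb, hb1⟩
    exact hb2 h4.2

/-- An element fixing two opposite chambers `B` and `w₀B` of the standard apartment is in `T`. -/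
theorem mem_T_of_mem_stab {n₀ : D.N}
    (h₀ : ∀ s ∈ S, wordLen S (s * D.toW n₀) < wordLen S (D.toW n₀)) {x : Γ} (hx : x ∈ D.B)
    (hx' : x ∈ D.stab n₀) : x ∈ D.T := by
  have hF := hD.isFolding
  -- Every chamber `mB` of the apartment lies on a minimal gallery from `B` to `n₀B`.
  refine (hD.saturated x).1 fun m hm => ⟨m⁻¹ * x * m, ?_, by group⟩
  have h1 := hF.len_of_descent subset_rfl h₀ (hF.mem (D.toW ⟨m, hm⟩))
  rw [← mem_stab]
  refine hD.mem_stab_of_mem_stab_mul (v := D.toW ⟨m, hm⟩) (w := (D.toW ⟨m, hm⟩)⁻¹ * D.toW n₀)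
    (h := m⁻¹ * n₀) (by rw [mul_inv_cancel_left]; omega) (mem_cell_toW ⟨m, hm⟩) ?_ hx (by simpa)
  rw [← map_inv, ← map_mul]
  exact mem_cell_toW (⟨m, hm⟩⁻¹ * n₀)

theorem conj_mem_U {b u : Γ} (hb : b ∈ D.B) (hu : u ∈ D.U) : b * u * b⁻¹ ∈ D.U := by
  have := hD.normal_U.conj_mem ⟨u, hD.U_le_B hu⟩ hu ⟨b, hb⟩
  exact this

theorem isLongest_iff [Finite D.W] {w : D.W} :
    D.IsLongest S w ↔ ∀ s ∈ S, wordLen S (s * w) < wordLen S w := by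
  have hF := hD.isFolding
  constructor
  · intro h s hs
    have h1 : wordLen S (s * w) ≤ wordLen S w := h (s * w)
    exact lt_of_le_of_ne h1 (hF.ne s hs w)
  · intro h v
    have := hF.len_of_descent subset_rfl h (hF.mem v)
    change wordLen S v ≤ wordLen S w
    omega

theorem isLongest_inv {w : D.W} (hw : D.IsLongest S w) : D.IsLongest S w⁻¹ := by
  intro v
  have h1 : wordLen S v ≤ wordLen S w := hw v
  change wordLen S v ≤ wordLen S w⁻¹
  rwa [hD.isFolding.len_inv]

theorem mem_stab_of_mem_Uof {n n₀ : D.N} (hn₀ : D.IsLongest S (D.toW n₀)) {x : Γ}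
    (hx : x ∈ D.Uof S (D.toW n)) : x ∈ D.U ∧ x ∈ D.stab ((n₀ : Γ) * n)⁻¹ := by
  refine ⟨hx.1, ?_⟩
  have h1 := (Subgroup.mem_inf.1 hx).2
  simp only [Subgroup.mem_iInf] at h1
  have h2 := hD.U_le_B (h1 n n₀ rfl hn₀)
  rw [mem_stab]
  simpa [mul_assoc] using h2

variable [Finite D.W]

theorem exists_longest_rep : ∃ n₀ : D.N, D.IsLongest S (D.toW n₀) := by
  obtain ⟨w, -, hw, -⟩ := hD.isFolding.exists_longest (K := S) subset_rfl
  obtain ⟨n, rfl⟩ := D.toW_surjective w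
  exact ⟨n, hD.isLongest_iff.2 hw⟩

/-- `U_s` fixes the chambers of the half-apartment of the `w` with `l(sw) > l(w)`. -/
theorem mem_stab_of_ascent {s : D.W} (hs : s ∈ S) {x : Γ} (hx : x ∈ D.Uof S s) {m : D.N}
    (hm : wordLen S (D.toW m) < wordLen S (s * D.toW m)) : x ∈ D.stab m := by
  have hF := hD.isFolding
  obtain ⟨n, rfl⟩ := D.toW_surjective s
  obtain ⟨n₀, hn₀⟩ := hD.exists_longest_rep
  obtain ⟨h1, h2⟩ := hD.mem_stab_of_mem_Uof hn₀ hx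
  have h3 := hD.isLongest_iff.1 (hD.isLongest_inv hn₀)
  have h4 := hF.len_of_descent subset_rfl h3 (hF.mem (D.toW n)⁻¹)
  have h5 := hF.len_of_descent subset_rfl h3 (hF.mem (D.toW n * D.toW m))
  have h6 := hF.len_left hs (D.toW m)
  have h7 := hF.len_one hs
  rw [hF.len_inv, inv_inv] at h4
  have e1 : D.toW m * ((D.toW m)⁻¹ * ((D.toW n)⁻¹ * (D.toW n₀)⁻¹)) = D.toW n * (D.toW n₀)⁻¹ := by
    rw [hD.inv_eq hs]; group
  have e2 : (D.toW m)⁻¹ * ((D.toW n)⁻¹ * (D.toW n₀)⁻¹) =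
    (D.toW n * D.toW m)⁻¹ * (D.toW n₀)⁻¹ := by group
  -- `x` fixes `B` and `(n₀ n)⁻¹ B`, at distance `s w₀⁻¹` of length `l(w₀) - 1`; the ascent makes
  -- `mB` lie on a minimal gallery between them.
  refine hD.mem_stab_of_mem_stab_mul (v := D.toW m)
    (w := (D.toW m)⁻¹ * ((D.toW n)⁻¹ * (D.toW n₀)⁻¹)) (h := (m : Γ)⁻¹ * ((n₀ : Γ) * n)⁻¹) ?_
    (mem_cell_toW m) ?_ (hD.U_le_B h1) (by simpa using h2)
  · rw [e1, e2]
    omega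
  · simpa using mem_cell_toW (m⁻¹ * (n₀ * n)⁻¹)

/-- `U_s` acts freely on the chambers `s`-adjacent to `B`. -/
theorem eq_one_of_mem_stab {s : D.W} (hs : s ∈ S) {x : Γ} (hx : x ∈ D.Uof S s) {p : Γ}
    (hp : p ∈ D.cell s) (hxp : x ∈ D.stab p) : x = 1 := by
  have hF := hD.isFolding
  obtain ⟨n, rfl⟩ := D.toW_surjective s
  obtain ⟨n₀, hn₀⟩ := hD.exists_longest_rep
  obtain ⟨h1, h2⟩ := hD.mem_stab_of_mem_Uof hn₀ hx
  have h3 := hD.isLongest_iff.1 (hD.isLongest_inv hn₀)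
  have h4 := hF.len_of_descent subset_rfl h3 (hF.mem (D.toW n)⁻¹)
  have h7 := hF.len_one hs
  rw [hF.len_inv, inv_inv] at h4
  have h5 : wordLen S (D.toW n₀ * D.toW n) = wordLen S (D.toW n * (D.toW n₀)⁻¹) := by
    rw [← hF.len_inv, mul_inv_rev, hD.inv_eq hs]
  rw [hF.len_inv] at h4
  obtain ⟨b, hb, hb1, hb2⟩ := hD.exists_stab_transitive (v := D.toW n₀ * D.toW n) (w := D.toW n)
    (by rw [hF.mul_mul_cancel_right hs]; omega) (g := (n₀ : Γ) * n)
    (by simpa using mem_cell_toW (n₀ * n)) (mem_cell_toW n) hp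
  -- pass to `y`, a conjugate of `x` that fixes three chambers of the standard apartment
  set g : Γ := (n₀ : Γ) * n with hg
  set c : Γ := g⁻¹ * b * g with hc
  have hcB : c ∈ D.B := mem_stab.1 hb1
  have hpc : p⁻¹ * (c * n) ∈ D.B := by
    have : p⁻¹ * (c * n) = (g * p)⁻¹ * (b * (g * n)) := by rw [hc]; group
    rwa [this]
  set y : Γ := c⁻¹ * x * c with hy
  have hyU : y ∈ D.U := by simpa using hD.conj_mem_U (inv_mem hcB) h1
  have hyn : y ∈ D.stab n := by
    rw [mem_stab_of_inv_mul_mem hpc, mem_stab_mul] at hxp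
    exact hxp
  have hyg : g * y * g⁻¹ ∈ D.B := by
    rw [mem_stab] at h2
    have : g * y * g⁻¹ = b⁻¹ * ((g⁻¹)⁻¹ * x * g⁻¹) * b := by rw [hy, hc]; group
    rw [this]
    exact mul_mem (mul_mem (inv_mem hb) h2) hb
  have hnn : (n : Γ) * n ∈ D.B := by
    have := D.toW_eq_one (n := n * n)
    rw [map_mul, hD.sq _ hs] at this
    exact this.1 rfl
  have hyg' : g * y * g⁻¹ ∈ D.stab n₀ := by
    rw [mem_stab]
    rw [mem_stab] at hyn
    have : (n₀ : Γ)⁻¹ * (g * y * g⁻¹) * n₀ =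
      (n * n : Γ) * ((n : Γ)⁻¹ * y * n) * (n * n : Γ)⁻¹ := by rw [hg]; group
    rw [this]
    exact mul_mem (mul_mem hnn hyn) (inv_mem hnn)
  -- `g y g⁻¹` fixes the opposite chambers `B` and `n₀B`, so it is in `T`; hence so is `y`, and `T ⊓
  -- U` is trivial.
  have hyT := hD.mem_T_of_mem_stab (hD.isLongest_iff.1 hn₀) hyg hyg'
  have hyT' : y ∈ D.T := by
    have := conj_mem_T (n := (n₀ * n)⁻¹) hyT
    simpa [hg, mul_assoc] using this
  have hy1 : y = 1 := by
    have : y ∈ D.T ⊓ D.U := ⟨hyT', hyU⟩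
    rwa [hD.T_inf_U, Subgroup.mem_bot] at this
  have : x = c * y * c⁻¹ := by rw [hy]; group
  rw [this, hy1]
  group

end IsBNPair

end BNTriple

/-! ### Comparing `C_J` and `C_K` up to finite index. -/

namespace BNTriple

variable {Γ : Type*} [Group Γ] {D : BNTriple Γ}

theorem relIndex_Uof_eq_zero {S : Set D.W} {s : D.W} (hU : (D.Uof S s : Set Γ).Infinite)
    {X : Subgroup Γ} {h : Γ} (H : ∀ z ∈ D.Uof S s, h⁻¹ * z * h ∈ X → z = 1) :
    X.relIndex ((D.Uof S s).comap (MulAut.conj h).toMonoidHom) = 0 := by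
  have h1 : X ⊓ (D.Uof S s).comap (MulAut.conj h).toMonoidHom = ⊥ := by
    rw [eq_bot_iff]
    intro x hx
    have h2 := H (h * x * h⁻¹) (by simpa using hx.2) (by simpa [mul_assoc] using hx.1)
    simpa using h2
  rw [← Subgroup.inf_relIndex_right, h1, Subgroup.relIndex_bot_left]
  by_contra h3
  have h4 : Finite ((D.Uof S s).comap (MulAut.conj h).toMonoidHom) :=
    Nat.finite_of_card_ne_zero h3
  refine hU (Set.Finite.subset ((Set.toFinite
    (((D.Uof S s).comap (MulAut.conj h).toMonoidHom : Subgroup Γ) : Set Γ)).image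
      fun x => h * x * h⁻¹) fun x hx => ⟨h⁻¹ * x * h, ?_, by group⟩)
  simpa [mul_assoc] using hx

namespace IsBNPair

variable {S : Set D.W} (hD : D.IsBNPair S)

include hD

/-- Since `y` is longest in `y W_K`, some minimal gallery from `B` to `gB` ends with a segment from
`aB` to `a n B = gB`; whoever fixes `B` and `gB` fixes both ends of that segment. -/
theorem exists_le_comap_conj {K : Set D.W} (hK : K ⊆ S) {n : D.N}
    (hn : D.toW n ∈ Subgroup.closure K) {y : D.W}
    (hy : ∀ t ∈ K, wordLen S (y * t) < wordLen S y) {g : Γ} (hg : g ∈ D.cell y) :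
    ∃ a ∈ D.cell (y * (D.toW n)⁻¹), D.B ⊓ D.stab g ≤
      (D.B ⊓ D.stab n).comap (MulAut.conj a⁻¹).toMonoidHom := by
  have h1 := hD.isFolding.len_of_descent_right hK hy (inv_mem hn)
  rw [hD.isFolding.len_inv] at h1
  have e : y = y * (D.toW n)⁻¹ * D.toW n := by group
  rw [e] at hg
  obtain ⟨a, ha, c, hc, rfl⟩ := cell_split hg
  obtain ⟨b, hb, b', hb', rfl⟩ := exists_eq_of_mem_cell hc
  refine ⟨a * b, mem_cell_mul ha hb, fun x hx => ?_⟩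
  have h2 : x ∈ D.stab (a * b * n) := by
    refine (mem_stab_of_inv_mul_mem ?_).1 hx.2
    have : (a * (b * n * b'))⁻¹ * (a * b * n) = b'⁻¹ := by group
    rw [this]
    exact inv_mem hb'
  have h3 : x ∈ D.stab (a * b) := by
    refine hD.mem_stab_of_mem_stab_mul ?_ (mem_cell_mul ha hb) (mem_cell_toW n) hx.1 h2
    rw [← e]
    omega
  refine ⟨?_, ?_⟩
  · simpa [mem_stab, mul_assoc] using h3
  · simpa [mem_stab, mul_assoc] using h2

variable [Finite D.W]

/-- An `s` outside `J` is never a left descent of an element of `W_J`, so `nB` lies in the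
half-apartment fixed by `U_s`. -/
theorem Uof_le_stab {J : Set D.W} (hJ : J ⊆ S) {n : D.N}
    (hn : D.toW n ∈ Subgroup.closure J) {s : D.W} (hs : s ∈ S) (hsJ : s ∉ J) :
    D.Uof S s ≤ D.B ⊓ D.stab n := by
  refine fun x hx => ⟨hD.U_le_B (Subgroup.mem_inf.1 hx).1, hD.mem_stab_of_ascent hs hx ?_⟩
  have h1 := hD.isFolding.ne s hs (D.toW n)
  by_contra h2
  exact hsJ (hD.isFolding.mem_of_descent hJ hs hn (by omega))

theorem subset_of_relIndex {C : Subgroup Γ → Prop} (hC : IsNoetherianClass C) (hB : C D.B)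
    (hU : ∀ s ∈ S, (D.Uof S s : Set Γ).Infinite) {J K : Set D.W} (hJ : J ⊆ S) (hK : K ⊆ S)
    {nJ nK : D.N} (hnJ : D.toW nJ ∈ Subgroup.closure J) (hnK : D.toW nK ∈ Subgroup.closure K)
    (hnK' : ∀ t ∈ K, wordLen S (t * D.toW nK) < wordLen S (D.toW nK))
    {y : D.W} (hy : ∀ t ∈ K, wordLen S (y * t) < wordLen S y) {g : Γ} (hg : g ∈ D.cell y)
    (hJK : (D.B ⊓ D.stab g).relIndex (D.B ⊓ D.stab nJ) ≠ 0)
    {y' : D.W} (hy' : ∀ t ∈ J, wordLen S (y' * t) < wordLen S y') {g' : Γ} (hg' : g' ∈ D.cell y')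
    (hKJ : (D.B ⊓ D.stab g').relIndex (D.B ⊓ D.stab nK) ≠ 0) : K ⊆ J := by
  have hF := hD.isFolding
  obtain ⟨a, ha, hXa⟩ := hD.exists_le_comap_conj hK hnK hy hg
  obtain ⟨a', -, hXa'⟩ := hD.exists_le_comap_conj hJ hnJ hy' hg'
  set X := D.B ⊓ D.stab g with hX
  set CJ := D.B ⊓ D.stab nJ with hCJ
  set CK := D.B ⊓ D.stab nK with hCK
  have hcl : C CJ := hC.inf _ _ hB (hC.conj _ hB _)
  have h1 : (CK.comap (MulAut.conj a⁻¹).toMonoidHom).relIndex CJ ≠ 0 := fun h0 =>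
    hJK (Subgroup.relIndex_eq_zero_of_le_left hXa h0)
  have h2 : (CJ.comap (MulAut.conj a'⁻¹).toMonoidHom).relIndex CK ≠ 0 := fun h0 =>
    hKJ (Subgroup.relIndex_eq_zero_of_le_left hXa' h0)
  rw [← relIndex_comap_conj _ _ a⁻¹, comap_conj_comap_conj] at h2
  have h3 := Subgroup.relIndex_ne_zero_trans h2 h1
  set z := a'⁻¹ * a⁻¹ with hz
  -- The chain condition reverses `h3`; this is what allows `X` to be compared with the whole
  -- conjugate of `CK` in `h5`.
  have h4 : CJ.relIndex (CJ.comap (MulAut.conj z).toMonoidHom) ≠ 0 := by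
    rw [← relIndex_comap_conj _ _ z⁻¹, comap_conj_comap_conj, mul_inv_cancel, comap_conj_one] at h3
    have h5 := hC.relIndex_comap_conj_ne_zero hcl _ h3
    rwa [← relIndex_comap_conj _ _ z, comap_conj_comap_conj, inv_mul_cancel, comap_conj_one] at h5
  have h5 : X.relIndex (CK.comap (MulAut.conj a⁻¹).toMonoidHom) ≠ 0 :=
    Subgroup.relIndex_ne_zero_trans (Subgroup.relIndex_ne_zero_trans hJK h4) h2
  have hy1 : y * (D.toW nK)⁻¹ = 1 := by
    by_contra h1
    obtain ⟨t, ht, y₂, -, e, hy₂⟩ := exists_right_letter hD.sq (hD.mem_closure _) h1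
    have htK : t ∉ K := fun htK => by
      have h6 := hF.len_of_descent_right hK hy (inv_mem hnK)
      have h7 := hF.len_of_descent_right hK hy
        (mul_mem (inv_mem hnK) (Subgroup.subset_closure htK))
      have h8 := hnK' t htK
      rw [← mul_assoc, e, hF.mul_mul_cancel_right ht, ← hF.len_inv ((D.toW nK)⁻¹ * t),
        mul_inv_rev, inv_inv, hD.inv_eq ht] at h7
      rw [hF.len_inv] at h6
      omega
    -- The conjugate of `U_t` lies in that of `CK` but meets `X` trivially: a common element would
    -- correspond to an element of `U_t` fixing a chamber `t`-adjacent to `B`.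
    have h6 : (D.Uof S t).comap (MulAut.conj a⁻¹).toMonoidHom ≤
        CK.comap (MulAut.conj a⁻¹).toMonoidHom :=
      Subgroup.comap_mono (hD.Uof_le_stab hK hnK ht htK)
    refine h5 (Subgroup.relIndex_eq_zero_of_le_right h6 (relIndex_Uof_eq_zero (hU t ht) ?_))
    intro x hx hx'
    have ha' := inv_mem_cell ha
    rw [e, mul_inv_rev, hD.inv_eq ht] at ha'
    obtain ⟨p, hp, q, hq, hpq⟩ := cell_split ha'
    refine hD.eq_one_of_mem_stab ht hx hp (hD.mem_stab_of_mem_stab_mul (w := y₂⁻¹) ?_ hp hq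
      (hD.U_le_B (Subgroup.mem_inf.1 hx).1) ?_)
    · rw [e] at hy₂
      have h7 := hF.len_inv (y₂ * t)
      rw [mul_inv_rev, hD.inv_eq ht] at h7
      rw [hF.len_inv, hF.len_one ht]
      omega
    · rw [← hpq, mem_stab]
      exact hx'.1
  have hyK : y = D.toW nK := by rwa [mul_inv_eq_one] at hy1
  subst hyK
  intro s hs
  by_contra hsJ
  -- For `s ∈ K \ J` the group `U_s` lies in `CJ`. It meets `X` trivially, since `w_K` has a reduced
  -- word starting with `s`.
  have h6 : ((D.Uof S s).comap (MulAut.conj (1 : Γ)).toMonoidHom) ≤ CJ := by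
    rw [comap_conj_one]
    exact hD.Uof_le_stab hJ hnJ (hK hs) hsJ
  refine hJK (Subgroup.relIndex_eq_zero_of_le_right h6 (relIndex_Uof_eq_zero (hU s (hK hs)) ?_))
  intro x hx hx'
  rw [← hF.mul_mul_cancel (hK hs) (D.toW nK)] at hg
  obtain ⟨p, hp, q, hq, rfl⟩ := cell_split hg
  refine hD.eq_one_of_mem_stab (hK hs) hx hp (hD.mem_stab_of_mem_stab_mul ?_ hp hq
    (hD.U_le_B (Subgroup.mem_inf.1 hx).1) (by simpa using hx'.2))
  have h7 := hnK' s hs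
  have h8 := hF.len_left (hK hs) (D.toW nK)
  rw [hF.mul_mul_cancel (hK hs), hF.len_one (hK hs)]
  omega

end IsBNPair

end BNTriple

/-! ### Elimination of leading terms. -/

/-- Elimination of leading terms: if every leading coefficient of an element of `Q` can be removed
by an element of `Q ⊓ V`, then `Q ≤ V`. -/
theorem Finsupp.le_of_leading {k α : Type*} [Field k] (l : α → ℕ) {Q V : Submodule k (α →₀ k)}
    (H : ∀ f ∈ Q, ∀ c, f c ≠ 0 → (∀ d, f d ≠ 0 → l d ≤ l c) →
      ∃ b ∈ Q, b ∈ V ∧ b c = 1 ∧ ∀ d, b d ≠ 0 → d ≠ c → l d < l c) : Q ≤ V := by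
  classical
  suffices H' : ∀ n, ∀ f ∈ Q, (∀ d, f d ≠ 0 → l d < n) → f ∈ V by
    intro f hf
    refine H' (f.support.sup l + 1) f hf fun d hd => ?_
    exact Nat.lt_succ_of_le (Finset.le_sup (f := l) (Finsupp.mem_support_iff.2 hd))
  intro n
  induction n with
  | zero =>
    intro f _ h
    have : f = 0 := by
      ext d
      by_contra hd
      exact absurd (h d hd) (by omega)
    rw [this]
    exact zero_mem _
  | succ n ih =>
    intro f hf h
    have H1 : ∀ c, ∃ b : α →₀ k, f c ≠ 0 ∧ l c = n →
        b ∈ Q ∧ b ∈ V ∧ b c = 1 ∧ ∀ d, b d ≠ 0 → d ≠ c → l d < l c := by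
      intro c
      by_cases hc : f c ≠ 0 ∧ l c = n
      · obtain ⟨b, h1, h2⟩ := H f hf c hc.1 fun d hd => by have := h d hd; omega
        exact ⟨b, fun _ => ⟨h1, h2⟩⟩
      · exact ⟨0, fun h => absurd h hc⟩
    choose b hb using H1
    set s := f.support.filter fun c => l c = n with hs
    have hsm : ∀ c ∈ s, f c ≠ 0 ∧ l c = n := fun c hc => by simpa [hs] using hc
    set e := ∑ c ∈ s, f c • b c with he
    have heQ : e ∈ Q := Submodule.sum_mem _ fun c hc => Submodule.smul_mem _ _ (hb c (hsm c hc)).1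
    have heV : e ∈ V := Submodule.sum_mem _ fun c hc => Submodule.smul_mem _ _ (hb c (hsm c hc)).2.1
    have h1 : f - e ∈ V := by
      refine ih _ (sub_mem hf heQ) fun d hd => ?_
      by_contra hdn
      refine hd ?_
      -- The corrections for different top-level points do not interfere: away from `c`, `b c` lives
      -- on lower levels.
      have h2 : ∀ c ∈ s, c ≠ d → b c d = 0 := fun c hc hcd => by
        by_contra h3
        have := (hb c (hsm c hc)).2.2.2 d h3 hcd.symm
        have := (hsm c hc).2
        omega
      rw [Finsupp.sub_apply, he, Finsupp.finsetSum_apply, sub_eq_zero]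
      by_cases hds : d ∈ s
      · rw [Finset.sum_eq_single_of_mem d hds fun c hc hcd => by simp [h2 c hc hcd]]
        simp [(hb d (hsm d hds)).2.2.1]
      · rw [Finset.sum_eq_zero fun c hc => by
          simp [h2 c hc (by rintro rfl; exact hds hc)]]
        by_contra hfd
        refine hds ?_
        have := h d hfd
        simp only [hs, Finset.mem_filter, Finsupp.mem_support_iff]
        exact ⟨hfd, by omega⟩
    have := add_mem h1 heV
    rwa [sub_add_cancel] at this

/-! ### Functions on chambers and sums over residues. -/

namespace BNTriple

variable {Γ : Type*} [Group Γ] (D : BNTriple Γ)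

/-- The parabolic subgroup generated by `B` and the preimage of `W_L` in `N`. -/
def parabolic (L : Set D.W) : Subgroup Γ :=
  D.B ⊔ ((Subgroup.closure L).comap D.toW).map D.N.subtype

theorem B_le_parabolic (L : Set D.W) : D.B ≤ D.parabolic L := le_sup_left

theorem parabolic_mono {L L' : Set D.W} (h : L ⊆ L') : D.parabolic L ≤ D.parabolic L' :=
  sup_le_sup_left (Subgroup.map_mono (Subgroup.comap_mono (Subgroup.closure_mono h))) _

theorem mem_parabolic_of_toW_mem {L : Set D.W} {n : D.N} (hn : D.toW n ∈ Subgroup.closure L) :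
    (n : Γ) ∈ D.parabolic L :=
  (le_sup_right : _ ≤ D.parabolic L) ⟨n, hn, rfl⟩

/-- A representative in `N` of an element of `W`. -/
noncomputable def rep (w : D.W) : D.N := Quotient.out w

@[simp] theorem toW_rep (w : D.W) : D.toW (D.rep w) = w := Quotient.out_eq w

theorem rep_mem_cell (w : D.W) : (D.rep w : Γ) ∈ D.cell w := by
  simpa using mem_cell_toW (D.rep w)

/-- The `W`-valued distance of a chamber from the base chamber. -/
noncomputable def pos (c : Γ ⧸ D.B) : D.W :=
  Classical.epsilon fun w => Quotient.out c ∈ D.cell w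

theorem IsBNPair.pos_mk {D : BNTriple Γ} {S : Set D.W} (hD : D.IsBNPair S) {g : Γ} {w : D.W}
    (hg : g ∈ D.cell w) : D.pos (g : Γ ⧸ D.B) = w := by
  obtain ⟨b, hb⟩ := QuotientGroup.mk_out_eq_mul D.B g
  have h1 : Quotient.out (g : Γ ⧸ D.B) ∈ D.cell w := by
    rw [hb]
    exact mem_cell_mul hg b.2
  exact hD.cell_unique (Classical.epsilon_spec (p := fun w => Quotient.out (g : Γ ⧸ D.B) ∈ D.cell w)
    ⟨w, h1⟩) h1

variable (k : Type*) [Field k]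

/-- Translation of functions on `Γ / H`. -/
noncomputable def trans (H : Subgroup Γ) (g : Γ) : (Γ ⧸ H →₀ k) →ₗ[k] (Γ ⧸ H →₀ k) :=
  Finsupp.lmapDomain k k (g • ·)

theorem trans_single (H : Subgroup Γ) (g h : Γ) (a : k) :
    trans k H g (Finsupp.single (h : Γ ⧸ H) a) = Finsupp.single ((g * h : Γ) : Γ ⧸ H) a := by
  simp [trans, Finsupp.mapDomain_single]

theorem trans_mul (H : Subgroup Γ) (g h : Γ) (f : Γ ⧸ H →₀ k) :
    trans k H (g * h) f = trans k H g (trans k H h f) := by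
  simp only [trans, Finsupp.lmapDomain_apply]
  rw [← Finsupp.mapDomain_comp]
  congr 1
  ext x
  simp [mul_smul]

theorem trans_apply_smul (H : Subgroup Γ) (g : Γ) (f : Γ ⧸ H →₀ k) (x : Γ ⧸ H) :
    trans k H g f (g • x) = f x :=
  Finsupp.mapDomain_apply (MulAction.injective g) f x

/-- The push-forward of functions on chambers to functions on residues of type `L`. -/
noncomputable def push (L : Set D.W) : (Γ ⧸ D.B →₀ k) →ₗ[k] (Γ ⧸ D.parabolic L →₀ k) :=
  Finsupp.lmapDomain k k (Subgroup.quotientMapOfLE (D.B_le_parabolic L))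

theorem push_single (L : Set D.W) (g : Γ) (a : k) :
    D.push k L (Finsupp.single (g : Γ ⧸ D.B) a) =
      Finsupp.single (g : Γ ⧸ D.parabolic L) a := by
  simp [push, Finsupp.mapDomain_single]

theorem push_trans (L : Set D.W) (g : Γ) (f : Γ ⧸ D.B →₀ k) :
    D.push k L (trans k D.B g f) = trans k (D.parabolic L) g (D.push k L f) := by
  simp only [push, trans, Finsupp.lmapDomain_apply]
  rw [← Finsupp.mapDomain_comp, ← Finsupp.mapDomain_comp]
  congr 1
  ext x
  induction x using QuotientGroup.induction_on with
  | H x => rfl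

theorem push_eq_zero_of_subset {L L' : Set D.W} (h : L ⊆ L') {f : Γ ⧸ D.B →₀ k}
    (hf : D.push k L f = 0) : D.push k L' f = 0 := by
  have h1 : D.push k L' f =
      Finsupp.mapDomain (Subgroup.quotientMapOfLE (D.parabolic_mono h)) (D.push k L f) := by
    simp only [push, Finsupp.lmapDomain_apply]
    rw [← Finsupp.mapDomain_comp]
    congr 1
    ext x
    induction x using QuotientGroup.induction_on with
    | H x => rfl
  rw [h1, hf, Finsupp.mapDomain_zero]

theorem push_apply_eq (L : Set D.W) (f : Γ ⧸ D.B →₀ k) (g : Γ)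
    (H : ∀ h : Γ, g⁻¹ * h ∈ D.parabolic L → g⁻¹ * h ∉ D.B → f h = 0) :
    D.push k L f (g : Γ ⧸ D.parabolic L) = f g := by
  classical
  rw [push, Finsupp.lmapDomain_apply, Finsupp.mapDomain, Finsupp.sum_apply]
  rw [Finsupp.sum, Finset.sum_eq_single (g : Γ ⧸ D.B)]
  · simp
  · intro d hd hdg
    induction d using QuotientGroup.induction_on with
    | H h =>
      rw [Subgroup.quotientMapOfLE_apply_mk, Finsupp.single_apply, if_neg]
      intro h1
      refine Finsupp.mem_support_iff.1 hd (H h (QuotientGroup.eq.1 h1.symm) fun h2 => ?_)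
      exact hdg (QuotientGroup.eq.2 h2).symm
  · intro h
    simp [Finsupp.notMem_support_iff.1 h]

/-- The functions on chambers with vanishing sums over all panels of type `s ∈ J`. -/
noncomputable def cycles (J : Set D.W) : Submodule k (Γ ⧸ D.B →₀ k) :=
  ⨅ s ∈ J, LinearMap.ker (D.push k {s})

theorem mem_cycles {J : Set D.W} {f : Γ ⧸ D.B →₀ k} :
    f ∈ D.cycles k J ↔ ∀ s ∈ J, D.push k {s} f = 0 := by
  simp [cycles]

theorem cycles_anti {J K : Set D.W} (h : J ⊆ K) : D.cycles k K ≤ D.cycles k J := fun f hf => by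
  rw [mem_cycles] at hf ⊢
  exact fun s hs => hf s (h hs)

theorem trans_mem_cycles {J : Set D.W} {f : Γ ⧸ D.B →₀ k} (hf : f ∈ D.cycles k J) (g : Γ) :
    trans k D.B g f ∈ D.cycles k J := by
  rw [mem_cycles] at hf ⊢
  intro s hs
  rw [push_trans, hf s hs, map_zero]

theorem push_eq_zero_of_mem_cycles {K L : Set D.W} {f : Γ ⧸ D.B →₀ k} (hf : f ∈ D.cycles k K)
    {t : D.W} (htK : t ∈ K) (htL : t ∈ L) : D.push k L f = 0 :=
  D.push_eq_zero_of_subset k (Set.singleton_subset_iff.2 htL) ((D.mem_cycles k).1 hf t htK)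

/-- Some `t ∈ K` lies in `S \ J`, and a residue of type `S \ J` is a union of `t`-panels. -/
theorem iSup_cycles_le_ker_push {S J : Set D.W} :
    (⨆ (K : Set D.W) (_ : J ⊂ K ∧ K ⊆ S), D.cycles k K) ≤ LinearMap.ker (D.push k (S \ J)) := by
  refine iSup₂_le fun K hK f hf => ?_
  obtain ⟨t, htK, htJ⟩ := Set.exists_of_ssubset hK.1
  exact D.push_eq_zero_of_mem_cycles k hf htK ⟨hK.2 htK, htJ⟩

/-- The alternating sum over the chambers `wB`, `w ∈ W_J`. -/
noncomputable def altSum [Finite D.W] (S J : Set D.W) : Γ ⧸ D.B →₀ k :=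
  ∑ w ∈ (Set.toFinite (Subgroup.closure J : Set D.W)).toFinset,
    (-1 : k) ^ wordLen S w • Finsupp.single ((D.rep w : Γ) : Γ ⧸ D.B) 1

/-- The span of the translates `u n η_J`. -/
noncomputable def altSpan [Finite D.W] (S J : Set D.W) : Submodule k (Γ ⧸ D.B →₀ k) :=
  Submodule.span k {f | ∃ u ∈ D.U, ∃ n ∈ D.N, f = trans k D.B u (trans k D.B n (D.altSum k S J))}

variable {D}

section AltSum

variable [Finite D.W] {S : Set D.W}

theorem trans_altSum (J : Set D.W) (g : Γ) : trans k D.B g (D.altSum k S J) =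
    ∑ w ∈ (Set.toFinite (Subgroup.closure J : Set D.W)).toFinset,
      (-1 : k) ^ wordLen S w • Finsupp.single ((g * D.rep w : Γ) : Γ ⧸ D.B) 1 := by
  simp only [altSum, map_sum, map_smul, trans_single]

theorem sum_single_apply_one {α : Type*} (J : Set D.W) (p : D.W → α)
    (hp : ∀ w ∈ Subgroup.closure J, p w = p 1 → w = 1) :
    (∑ w ∈ (Set.toFinite (Subgroup.closure J : Set D.W)).toFinset,
      (-1 : k) ^ wordLen S w • Finsupp.single (p w) (1 : k)) (p 1) = 1 := by
  classical
  rw [Finsupp.finsetSum_apply, Finset.sum_eq_single 1]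
  · simp
  · intro w hw h1
    rw [Finsupp.smul_apply, Finsupp.single_apply, if_neg, smul_zero]
    intro h2
    exact h1 (hp w (by simpa using hw) h2)
  · simp

theorem trans_altSum_apply_self (J : Set D.W) (g : Γ) :
    trans k D.B g (D.altSum k S J) (g : Γ ⧸ D.B) = 1 := by
  have h1 : (D.rep 1 : Γ) ∈ D.B := D.toW_eq_one.1 (D.toW_rep 1)
  have h2 : (g : Γ ⧸ D.B) = ((g * D.rep 1 : Γ) : Γ ⧸ D.B) := by
    rw [QuotientGroup.eq]
    simpa using h1
  rw [trans_altSum, h2]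
  refine sum_single_apply_one k J (fun w => ((g * D.rep w : Γ) : Γ ⧸ D.B)) fun w _ hw => ?_
  rw [← h2, eq_comm, QuotientGroup.eq] at hw
  rw [← D.toW_rep w, D.toW_eq_one]
  simpa using hw

theorem exists_of_trans_altSum_apply_ne_zero {J : Set D.W} {g : Γ} {d : Γ ⧸ D.B}
    (hd : trans k D.B g (D.altSum k S J) d ≠ 0) :
    ∃ w ∈ Subgroup.closure J, d = ((g * D.rep w : Γ) : Γ ⧸ D.B) := by
  classical
  rw [trans_altSum, Finsupp.finsetSum_apply] at hd
  obtain ⟨w, hw, h⟩ := Finset.exists_ne_zero_of_sum_ne_zero hd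
  refine ⟨w, by simpa using hw, ?_⟩
  by_contra h1
  rw [Finsupp.smul_apply, Finsupp.single_apply, if_neg (Ne.symm h1)] at h
  simp at h

end AltSum

namespace IsBNPair

variable {S : Set D.W} (hD : D.IsBNPair S)

include hD

theorem mem_parabolic {L : Set D.W} (hL : L ⊆ S) {g : Γ} :
    g ∈ D.parabolic L ↔ ∃ x ∈ Subgroup.closure L, g ∈ D.cell x := by
  constructor
  · let Q : Subgroup Γ :=
      { carrier := {g | ∃ x ∈ Subgroup.closure L, g ∈ D.cell x}
        mul_mem' := by
          rintro a b ⟨x, hx, ha⟩ ⟨y, hy, hb⟩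
          obtain ⟨x', hx', h⟩ := hD.mul_cell_closure hL hx ha hb
          exact ⟨_, mul_mem hx' hy, h⟩
        one_mem' := ⟨1, one_mem _, mem_cell_one.2 (one_mem _)⟩
        inv_mem' := by
          rintro a ⟨x, hx, ha⟩
          exact ⟨_, inv_mem hx, inv_mem_cell ha⟩ }
    have h : D.parabolic L ≤ Q := by
      refine sup_le (fun b hb => ⟨1, one_mem _, mem_cell_one.2 hb⟩) ?_
      rintro _ ⟨n, hn, rfl⟩
      exact ⟨_, hn, mem_cell_toW n⟩
    exact fun hg => h hg
  · rintro ⟨x, hx, b, hb, n, rfl, b', hb', rfl⟩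
    exact mul_mem (mul_mem (D.B_le_parabolic L hb) (D.mem_parabolic_of_toW_mem hx))
      (D.B_le_parabolic L hb')

/-- The chamber `gB` is the unique shortest one in its residue of type `L`. -/
theorem lt_of_mem_parabolic {L : Set D.W} (hL : L ⊆ S) {y : D.W}
    (hy : ∀ t ∈ L, wordLen S y < wordLen S (y * t)) {g h : Γ} (hg : g ∈ D.cell y)
    (hgh : g⁻¹ * h ∈ D.parabolic L) (hB : g⁻¹ * h ∉ D.B) :
    wordLen S y < wordLen S (D.pos (h : Γ ⧸ D.B)) := by
  obtain ⟨x, hx, hx'⟩ := (hD.mem_parabolic hL).1 hgh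
  have h1 := hD.isFolding.len_mul_of_ascent_right hL hy hx
  have h2 := hD.mul_cell_add h1 hg hx'
  rw [mul_inv_cancel_left] at h2
  rw [hD.pos_mk h2, h1]
  by_contra h3
  have := eq_one_of_wordLen hD.sq (hD.mem_closure x) (by omega)
  subst this
  exact hB (mem_cell_one.1 hx')

theorem push_apply_of_leading {L : Set D.W} (hL : L ⊆ S) {y : D.W}
    (hy : ∀ t ∈ L, wordLen S y < wordLen S (y * t)) {g : Γ} (hg : g ∈ D.cell y)
    {f : Γ ⧸ D.B →₀ k} (hf : ∀ d, f d ≠ 0 → wordLen S (D.pos d) ≤ wordLen S y) :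
    D.push k L f (g : Γ ⧸ D.parabolic L) = f g := by
  refine D.push_apply_eq k L f g fun h h1 h2 => ?_
  by_contra h3
  have := hf _ h3
  have := hD.lt_of_mem_parabolic hL hy hg h1 h2
  omega

/-- If `y t` were longer than `y`, the other chambers of the `t`-panel of `gB` would be too long to
be in the support, and the vanishing panel sum would equal `f g`. -/
theorem descent_of_leading {J : Set D.W} (hJ : J ⊆ S) {f : Γ ⧸ D.B →₀ k}
    (hf : f ∈ D.cycles k J) {y : D.W} {g : Γ} (hg : g ∈ D.cell y) (hfg : f g ≠ 0)
    (hle : ∀ d, f d ≠ 0 → wordLen S (D.pos d) ≤ wordLen S y) :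
    ∀ t ∈ J, wordLen S (y * t) < wordLen S y := by
  intro t ht
  by_contra h1
  have h2 := hD.isFolding.len_right (hJ ht) y
  refine hfg ?_
  rw [← hD.push_apply_of_leading k (L := {t}) (Set.singleton_subset_iff.2 (hJ ht)) ?_ hg hle,
    (D.mem_cycles k).1 hf t ht, Finsupp.zero_apply]
  rintro _ rfl
  omega

theorem exists_U_N {g : Γ} {y : D.W} (hg : g ∈ D.cell y) :
    ∃ u ∈ D.U, ∃ n : D.N, D.toW n = y ∧ (u * n)⁻¹ * g ∈ D.B := by
  obtain ⟨b, hb, m, rfl, b', hb', rfl⟩ := hg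
  have h1 : b ∈ D.T ⊔ D.U := by rwa [hD.T_sup_U]
  have h2 : D.T ≤ Subgroup.normalizer (D.U : Set Γ) := by
    intro t ht
    rw [Subgroup.mem_normalizer_iff]
    intro u
    refine ⟨fun hu => hD.conj_mem_U ht.1 hu, fun hu => ?_⟩
    simpa [mul_assoc] using hD.conj_mem_U (inv_mem ht.1) hu
  rw [sup_comm, ← SetLike.mem_coe, Subgroup.coe_mul_of_right_le_normalizer_left _ _ h2] at h1
  obtain ⟨u, hu, t, ht, rfl⟩ := h1
  refine ⟨u, hu, ⟨t, ht.2⟩ * m, ?_, ?_⟩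
  · rw [map_mul, D.toW_eq_one.2 (show ((⟨t, ht.2⟩ : D.N) : Γ) ∈ D.B from ht.1), one_mul]
  · have : (u * ((⟨t, ht.2⟩ : D.N) * m : D.N))⁻¹ * (u * t * m * b') = b' := by
      simp [mul_assoc]
    simpa only [this] using hb'

/-- If the push-forward of `f` to the residues of type `L` is invariant under a subgroup `H` of `B`
and nonzero at the residue of a chamber that is shortest in this residue, then the stabilizer of
the chamber has finite index in `H`. -/
theorem relIndex_ne_zero_of_push {L : Set D.W} (hL : L ⊆ S) {H : Subgroup Γ} (hH : H ≤ D.B)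
    {f : Γ ⧸ D.B →₀ k}
    (hf : ∀ b ∈ H, trans k _ b (D.push k L f) = D.push k L f) {y : D.W}
    (hy : ∀ t ∈ L, wordLen S y < wordLen S (y * t)) {g : Γ} (hg : g ∈ D.cell y)
    (hne : D.push k L f (g : Γ ⧸ D.parabolic L) ≠ 0) :
    (D.B ⊓ D.stab g).relIndex H ≠ 0 := by
  set q : Γ ⧸ D.parabolic L := (g : Γ ⧸ D.parabolic L) with hq
  have horb : (MulAction.orbit H q).Finite := by
    -- By invariance the whole `H`-orbit of the residue lies in the support.
    refine (D.push k L f).support.finite_toSet.subset ?_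
    rintro _ ⟨b, rfl⟩
    have h1 := trans_apply_smul k _ (b : Γ) (D.push k L f) q
    rw [hf b b.2] at h1
    rw [Finset.mem_coe, Finsupp.mem_support_iff]
    change D.push k L f ((b : Γ) • q) ≠ 0
    rwa [h1]
  have h2 : (MulAction.stabilizer H q).index ≠ 0 := by
    rw [MulAction.index_stabilizer]
    exact (Set.ncard_pos horb).2 (MulAction.nonempty_orbit q) |>.ne'
  refine fun h0 => h2 (Nat.eq_zero_of_zero_dvd ?_)
  rw [← h0, Subgroup.relIndex]
  refine Subgroup.index_dvd_of_le fun b hb => ?_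
  have h3 : (b : Γ) • q = q := hb
  rw [hq, MulAction.Quotient.smul_mk, eq_comm, QuotientGroup.eq, smul_eq_mul] at h3
  rw [Subgroup.mem_subgroupOf]
  refine Subgroup.mem_inf.2 ⟨hH b.2, ?_⟩
  rw [mem_stab, mul_assoc]
  -- An element of `B` keeps `gB` in its cell, and no other chamber of the residue is as short.
  by_contra h4
  have h5 := hD.lt_of_mem_parabolic hL hy hg h3 h4
  rw [hD.pos_mk (mul_mem_cell (hH b.2) hg)] at h5
  omega

variable [Finite D.W]

/-- The chambers of `w` and `w s` share an `s`-panel and carry opposite signs. -/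
theorem altSum_mem_cycles {J : Set D.W} (hJ : J ⊆ S) : D.altSum k S J ∈ D.cycles k J := by
  rw [mem_cycles]
  intro s hs
  rw [altSum, map_sum]
  have hF := hD.isFolding
  refine Finset.sum_involution (fun w _ => w * s) ?_ ?_ ?_ ?_
  · intro w _
    have h1 : (((D.rep (w * s) : Γ)) : Γ ⧸ D.parabolic {s}) = ((D.rep w : Γ)) := by
      rw [eq_comm, QuotientGroup.eq]
      refine D.mem_parabolic_of_toW_mem (n := (D.rep w)⁻¹ * D.rep (w * s)) ?_
      simp
    simp only [map_smul, push_single, h1]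
    rw [← add_smul]
    rcases hF.len_right (hJ hs) w with h2 | h2
    · rw [h2, pow_succ]; simp
    · rw [← h2, pow_succ]; simp
  · intro w _ _ h
    exact hD.ne_one (hJ hs) (mul_eq_left.1 h)
  · intro w hw
    simp only [Set.Finite.mem_toFinset, SetLike.mem_coe] at hw ⊢
    exact mul_mem hw (Subgroup.subset_closure hs)
  · intro w _
    exact hF.mul_mul_cancel_right (hJ hs) w

/-- For `g ∈ B y B` with `ys < y` for all `s ∈ J`, a generator of `altSpan` with leading
chamber `gB`. -/
theorem exists_leading {J : Set D.W} (hJ : J ⊆ S) {y : D.W} {g : Γ} (hg : g ∈ D.cell y)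
    (hy : ∀ t ∈ J, wordLen S (y * t) < wordLen S y) :
    ∃ f ∈ D.cycles k J, f ∈ D.altSpan k S J ∧ f (g : Γ ⧸ D.B) = 1 ∧
      ∀ d, f d ≠ 0 → d ≠ (g : Γ ⧸ D.B) →
        wordLen S (D.pos d) < wordLen S (D.pos (g : Γ ⧸ D.B)) := by
  obtain ⟨u, hu, n, rfl, hug⟩ := hD.exists_U_N hg
  have e : ((u * n : Γ) : Γ ⧸ D.B) = (g : Γ ⧸ D.B) := QuotientGroup.eq.2 hug
  refine ⟨trans k D.B (u * n) (D.altSum k S J),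
    D.trans_mem_cycles k (hD.altSum_mem_cycles k hJ) _, ?_, ?_, ?_⟩
  · exact Submodule.subset_span ⟨u, hu, n, n.2, trans_mul k D.B _ _ _⟩
  · rw [← e]
    exact trans_altSum_apply_self k J _
  · intro d hd hdg
    obtain ⟨w, hw, rfl⟩ := exists_of_trans_altSum_apply_ne_zero k hd
    have h1 := hD.isFolding.len_of_descent_right hJ hy hw
    have h2 : u * n * D.rep w ∈ D.cell (D.toW n * w) := by
      rw [mul_assoc]
      refine mul_mem_cell (hD.U_le_B hu) ?_
      have h4 := mem_cell_toW (n * D.rep w)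
      rwa [map_mul, toW_rep] at h4
    rw [hD.pos_mk h2, hD.pos_mk hg]
    by_contra h3
    have := eq_one_of_wordLen hD.sq (hD.mem_closure w) (by omega)
    subst this
    refine hdg ?_
    rw [← e, eq_comm, QuotientGroup.eq, inv_mul_cancel_left]
    exact D.toW_eq_one.1 (D.toW_rep 1)

theorem altSpan_eq_cycles {J : Set D.W} (hJ : J ⊆ S) : D.altSpan k S J = D.cycles k J := by
  refine le_antisymm (Submodule.span_le.2 ?_)
    (Finsupp.le_of_leading (fun d => wordLen S (D.pos d)) fun f hf c hc hle => ?_)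
  · rintro _ ⟨u, -, n, -, rfl⟩
    exact D.trans_mem_cycles k (D.trans_mem_cycles k (hD.altSum_mem_cycles k hJ) _) _
  · induction c using QuotientGroup.induction_on with
    | H g =>
      obtain ⟨y, hy⟩ := hD.exists_mem_cell g
      refine hD.exists_leading k hJ hy (hD.descent_of_leading k hJ hf hy hc ?_)
      simpa only [hD.pos_mk hy] using hle

/-- A partial converse to `iSup_cycles_le_ker_push`. A leading chamber with descent set exactly `K`
is shortest in its residue of type `S \ K`, so the residue sum would be its nonzero coefficient.
Hence the descent set is larger, and the leading term is removable by a cycle for that larger set.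
-/
theorem mem_iSup_cycles {K : Set D.W} (hK : K ⊆ S) {f : Γ ⧸ D.B →₀ k} (hf : f ∈ D.cycles k K)
    (H : ∀ y, (∀ t ∈ K, wordLen S (y * t) < wordLen S y) →
      (∀ t ∈ S \ K, wordLen S y < wordLen S (y * t)) → ∀ g ∈ D.cell y,
      D.push k (S \ K) f (g : Γ ⧸ D.parabolic (S \ K)) = 0) :
    f ∈ ⨆ (K' : Set D.W) (_ : K ⊂ K' ∧ K' ⊆ S), D.cycles k K' := by
  let Q : Submodule k (Γ ⧸ D.B →₀ k) := D.cycles k K ⊓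
    ⨅ (y : D.W) (_ : ∀ t ∈ K, wordLen S (y * t) < wordLen S y)
      (_ : ∀ t ∈ S \ K, wordLen S y < wordLen S (y * t)) (g : Γ) (_ : g ∈ D.cell y),
      LinearMap.ker (Finsupp.lapply (R := k) (g : Γ ⧸ D.parabolic (S \ K)) ∘ₗ D.push k (S \ K))
  have hQ : ∀ f, f ∈ Q ↔ f ∈ D.cycles k K ∧ ∀ y, (∀ t ∈ K, wordLen S (y * t) < wordLen S y) →
      (∀ t ∈ S \ K, wordLen S y < wordLen S (y * t)) → ∀ g ∈ D.cell y, D.push k (S \ K) f (g : Γ ⧸ D.parabolic (S \ K)) = 0 := by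
    intro f
    simp only [Q, Submodule.mem_inf, Submodule.mem_iInf, LinearMap.mem_ker, LinearMap.comp_apply,
      Finsupp.lapply_apply]
  suffices hQV : Q ≤ ⨆ (K' : Set D.W) (_ : K ⊂ K' ∧ K' ⊆ S), D.cycles k K' from
    hQV ((hQ f).2 ⟨hf, H⟩)
  clear H hf f
  refine Finsupp.le_of_leading (fun d => wordLen S (D.pos d)) fun f hf c hc hle => ?_
  obtain ⟨hf, H⟩ := (hQ f).1 hf
  induction c using QuotientGroup.induction_on with
  | H g =>
    obtain ⟨y, hy⟩ := hD.exists_mem_cell g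
    have hle' : ∀ d, f d ≠ 0 → wordLen S (D.pos d) ≤ wordLen S y := by
      simpa only [hD.pos_mk hy] using hle
    have h1 := hD.descent_of_leading k hK hf hy hc hle'
    -- The full right descent set of `y`; once it properly contains `K`, cycles for it have zero
    -- sums over residues of type `S \ K` and so stay in `Q`.
    let K' : Set D.W := {t | t ∈ S ∧ wordLen S (y * t) < wordLen S y}
    have hKK' : K ⊆ K' := fun t ht => ⟨hK ht, h1 t ht⟩
    obtain ⟨t, ht, htK⟩ : ∃ t ∈ K', t ∉ K := by
      by_contra! h2
      have h5 : ∀ t ∈ S \ K, wordLen S y < wordLen S (y * t) := fun t ht => by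
        have h3 := hD.isFolding.len_right ht.1 y
        by_contra h4
        exact ht.2 (h2 t ⟨ht.1, by omega⟩)
      refine hc ?_
      rw [← H y h1 h5 g hy, hD.push_apply_of_leading k Set.sdiff_subset h5 hy hle']
    obtain ⟨b, hb, -, hb'⟩ := hD.exists_leading k (J := K') (fun t ht => ht.1) hy fun t ht => ht.2
    refine ⟨b, (hQ b).2 ⟨D.cycles_anti k hKK' hb, fun y' _ _ g' _ => ?_⟩, ?_, hb'⟩
    · rw [D.push_eq_zero_of_mem_cycles k (L := S \ K) hb ht ⟨ht.1, htK⟩, Finsupp.zero_apply]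
    · have h2 : K ⊂ K' ∧ K' ⊆ S := ⟨⟨hKK', fun h => htK (h ht)⟩, fun t ht => ht.1⟩
      exact Submodule.mem_iSup_of_mem K' (Submodule.mem_iSup_of_mem h2 hb)

/-- `W_J` and `W_{S \ J}` meet trivially, so the sum over the base residue of type `S \ J` is `1`,
whereas it vanishes on the larger cycle spaces. -/
theorem altSum_notMem {J : Set D.W} (hJ : J ⊆ S) :
    D.altSum k S J ∉ ⨆ (K : Set D.W) (_ : J ⊂ K ∧ K ⊆ S), D.cycles k K := by
  intro h
  have h2 : D.push k (S \ J) (D.altSum k S J) = 0 := D.iSup_cycles_le_ker_push k h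
  have h3 : D.push k (S \ J) (D.altSum k S J)
      (((D.rep 1 : Γ)) : Γ ⧸ D.parabolic (S \ J)) = 1 := by
    simp only [altSum, map_sum, map_smul, push_single]
    refine sum_single_apply_one k J (fun w => ((D.rep w : Γ) : Γ ⧸ D.parabolic (S \ J)))
      fun w hw h4 => ?_
    rw [eq_comm, QuotientGroup.eq] at h4
    obtain ⟨x, hx, h5⟩ := (hD.mem_parabolic Set.sdiff_subset).1 h4
    have h6 := hD.cell_unique h5 (mem_cell_toW ((D.rep 1)⁻¹ * D.rep w))
    simp only [map_mul, map_inv, toW_rep, inv_one, one_mul] at h6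
    exact hD.isFolding.eq_one_of_mem_of_mem hJ Set.sdiff_subset Set.disjoint_sdiff_right hw
      (h6 ▸ hx)
  rw [h2] at h3
  simp at h3

end IsBNPair

end BNTriple

/-! ### The induced module as functions on chambers, and the quotients `E_J`. -/

namespace BNTriple

variable {Γ : Type*} [Group Γ] (D : BNTriple Γ) (k : Type*) [Field k]

/-- The map from the induced module to the functions on chambers, `g ⊗ a ↦ a • g⁻¹B`. -/
noncomputable def indToFinsupp :
    Representation.IndV D.B.subtype (Representation.trivial k D.B k) →ₗ[k] (Γ ⧸ D.B →₀ k) :=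
  Representation.Coinvariants.lift _
    (Finsupp.lmapDomain k k (fun g : Γ => ((g⁻¹ : Γ) : Γ ⧸ D.B)) ∘ₗ
      (MonoidAlgebra.coeffLinearEquiv k).toLinearMap ∘ₗ
      (TensorProduct.rid k (MonoidAlgebra k Γ)).toLinearMap) (by
    intro b
    ext g
    simp [Finsupp.mapDomain_single, QuotientGroup.mk_mul_of_mem])

theorem indToFinsupp_mk (g : Γ) (a : k) :
    D.indToFinsupp k (Representation.IndV.mk D.B.subtype (Representation.trivial k D.B k) g a) =
      Finsupp.single ((g⁻¹ : Γ) : Γ ⧸ D.B) a := by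
  simp [indToFinsupp, Finsupp.mapDomain_single]

theorem mk_mul_of_mem {b : Γ} (hb : b ∈ D.B) (g : Γ) (a : k) :
    Representation.IndV.mk D.B.subtype (Representation.trivial k D.B k) (b * g) a =
      Representation.IndV.mk D.B.subtype (Representation.trivial k D.B k) g a := by
  have := Representation.Coinvariants.mk_self_apply
    (Representation.tprod ((Representation.leftRegular k Γ).comp D.B.subtype)
      (Representation.trivial k D.B k)) ⟨b, hb⟩ (MonoidAlgebra.single g 1 ⊗ₜ a)
  simpa using this

/-- The map from functions on chambers to the induced module. -/
noncomputable def finsuppToInd :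
    (Γ ⧸ D.B →₀ k) →ₗ[k] Representation.IndV D.B.subtype (Representation.trivial k D.B k) :=
  Finsupp.lsum k fun c => Representation.IndV.mk D.B.subtype (Representation.trivial k D.B k)
    (Quotient.out c)⁻¹

theorem finsuppToInd_single (g : Γ) (a : k) :
    D.finsuppToInd k (Finsupp.single (g : Γ ⧸ D.B) a) =
      Representation.IndV.mk D.B.subtype (Representation.trivial k D.B k) g⁻¹ a := by
  obtain ⟨b, hb⟩ := QuotientGroup.mk_out_eq_mul D.B g
  have h1 : (Quotient.out (g : Γ ⧸ D.B))⁻¹ = (b : Γ)⁻¹ * g⁻¹ := by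
    rw [hb, mul_inv_rev]
  rw [finsuppToInd, Finsupp.lsum_single, h1, D.mk_mul_of_mem k (inv_mem b.2)]

/-- The induced module is the module of finitely supported functions on the chambers. -/
noncomputable def indEquiv :
    Representation.IndV D.B.subtype (Representation.trivial k D.B k) ≃ₗ[k] (Γ ⧸ D.B →₀ k) :=
  LinearEquiv.ofLinearMap (D.indToFinsupp k) (D.finsuppToInd k)
    (by
      ext c : 2
      induction c using QuotientGroup.induction_on with
      | H g =>
        ext : 1
        simp only [LinearMap.comp_apply, Finsupp.lsingle_apply, LinearMap.id_apply]
        rw [finsuppToInd_single, indToFinsupp_mk, inv_inv])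
    (by
      refine Representation.IndV.hom_ext _ _ fun g => ?_
      ext : 1
      simp only [LinearMap.comp_apply, LinearMap.id_apply]
      rw [← LinearMap.comp_apply, ← LinearMap.comp_apply]
      have h1 := D.indToFinsupp_mk k g 1
      have h2 := D.finsuppToInd_single k g⁻¹ 1
      simp only [LinearMap.comp_apply] at h1 h2 ⊢
      rw [h1, h2, inv_inv])

theorem indEquiv_mk (g : Γ) (a : k) :
    D.indEquiv k (Representation.IndV.mk D.B.subtype (Representation.trivial k D.B k) g a) =
      Finsupp.single ((g⁻¹ : Γ) : Γ ⧸ D.B) a := D.indToFinsupp_mk k g a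

theorem indEquiv_ind (g : Γ)
    (x : Representation.IndV D.B.subtype (Representation.trivial k D.B k)) :
    D.indEquiv k (D.ind k g x) = trans k D.B g (D.indEquiv k x) := by
  suffices H : (D.indEquiv k).toLinearMap ∘ₗ D.ind k g =
      trans k D.B g ∘ₗ (D.indEquiv k).toLinearMap from LinearMap.congr_fun H x
  refine Representation.IndV.hom_ext _ _ fun h => ?_
  ext : 1
  have h1 := Representation.ind_mk D.B.subtype (Representation.trivial k D.B k) g h (1 : k)
  have h2 := D.indEquiv_mk k h 1
  have h3 := D.indEquiv_mk k (h * g⁻¹) 1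
  simp only [LinearMap.comp_apply, LinearEquiv.coe_coe, ind] at h1 h2 h3 ⊢
  rw [h1, h2, h3, trans_single]
  simp

theorem indEquiv_oneTr : D.indEquiv k (D.oneTr k) = Finsupp.single ((1 : Γ) : Γ ⧸ D.B) 1 := by
  rw [oneTr, indEquiv_mk, inv_one]

theorem indEquiv_eta [Finite D.W] (S J : Set D.W) :
    D.indEquiv k (D.eta k S J) = D.altSum k S J := by
  rw [eta, finsum_mem_eq_finite_toFinset_sum _ (Set.toFinite _), map_sum, altSum]
  refine Finset.sum_congr rfl fun w _ => ?_
  rw [map_smul, wOneTr, indEquiv_ind, indEquiv_oneTr, trans_single, mul_one]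
  rfl

theorem map_kUWEta [Finite D.W] (S J : Set D.W) :
    (D.kUWEta k S J).map (D.indEquiv k).toLinearMap = D.altSpan k S J := by
  rw [kUWEta, Submodule.map_span, altSpan]
  congr 1
  ext f
  constructor
  · rintro ⟨_, ⟨u, hu, n, hn, rfl⟩, rfl⟩
    refine ⟨u, hu, n, hn, ?_⟩
    rw [LinearEquiv.coe_coe, indEquiv_ind, indEquiv_ind, indEquiv_eta]
  · rintro ⟨u, hu, n, hn, rfl⟩
    refine ⟨_, ⟨u, hu, n, hn, rfl⟩, ?_⟩
    rw [LinearEquiv.coe_coe, indEquiv_ind, indEquiv_ind, indEquiv_eta]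

/-- The chamber function of an element of `M(tr)`. -/
noncomputable def chamberFn : D.Mtr k ≃ₗ[k] (Γ ⧸ D.B →₀ k) :=
  (D.ind k).asModuleEquiv ≪≫ₗ D.indEquiv k

theorem chamberFn_of_smul (g : Γ) (x : D.Mtr k) :
    D.chamberFn k (MonoidAlgebra.of k Γ g • x) = trans k D.B g (D.chamberFn k x) := by
  simp only [chamberFn, LinearEquiv.trans_apply, Representation.asModuleEquiv_map_smul]
  rw [MonoidAlgebra.of_apply, Representation.asAlgebraHom_single, one_smul, indEquiv_ind]

variable {D}

namespace IsBNPair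

variable {S : Set D.W} (hD : D.IsBNPair S) [Finite D.W]

include hD

theorem mem_kUWEta {J : Set D.W} (hJ : J ⊆ S)
    (x : Representation.IndV D.B.subtype (Representation.trivial k D.B k)) :
    x ∈ D.kUWEta k S J ↔ D.indEquiv k x ∈ D.cycles k J := by
  rw [← hD.altSpan_eq_cycles k hJ, ← map_kUWEta]
  exact ((D.indEquiv k).injective.mem_set_image (s := (D.kUWEta k S J : Set _))).symm

theorem ind_mem_kUWEta {J : Set D.W} (hJ : J ⊆ S) (g : Γ)
    {x : Representation.IndV D.B.subtype (Representation.trivial k D.B k)}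
    (hx : x ∈ D.kUWEta k S J) : D.ind k g x ∈ D.kUWEta k S J := by
  rw [hD.mem_kUWEta k hJ] at hx ⊢
  rw [indEquiv_ind]
  exact D.trans_mem_cycles k hx g

/-- Cycles are stable under the group, so passing to the `kG`-span adds nothing. -/
theorem mem_MtrJ {J : Set D.W} (hJ : J ⊆ S) (x : D.Mtr k) :
    x ∈ D.MtrJ k S J ↔ D.chamberFn k x ∈ D.cycles k J := by
  constructor
  · let Q : Submodule (MonoidAlgebra k Γ) (D.Mtr k) :=
      MonoidAlgebra.submoduleOfSMulMem ((D.cycles k J).comap (D.chamberFn k).toLinearMap)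
        fun g v hv => by
          rw [Submodule.mem_comap, LinearEquiv.coe_coe] at hv ⊢
          rw [chamberFn_of_smul]
          exact D.trans_mem_cycles k hv g
    have h : D.MtrJ k S J ≤ Q :=
      Submodule.span_le.2 fun y hy => (hD.mem_kUWEta k hJ _).1 hy
    exact fun hx => h hx
  · exact fun hx => Submodule.subset_span ((hD.mem_kUWEta k hJ _).2 hx)

theorem MtrJ_anti {J K : Set D.W} (hJK : J ⊆ K) (hK : K ⊆ S) : D.MtrJ k S K ≤ D.MtrJ k S J :=
  fun x hx => by
    rw [hD.mem_MtrJ k hK] at hx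
    rw [hD.mem_MtrJ k (hJK.trans hK)]
    exact D.cycles_anti k hJK hx

theorem MtrJ'_le {J : Set D.W} : D.MtrJ' k S J ≤ D.MtrJ k S J :=
  iSup₂_le fun _ hK => hD.MtrJ_anti k hK.1.subset hK.2

theorem mem_MtrJ' {J : Set D.W} (x : D.Mtr k) :
    x ∈ D.MtrJ' k S J ↔
      D.chamberFn k x ∈ ⨆ (K : Set D.W) (_ : J ⊂ K ∧ K ⊆ S), D.cycles k K := by
  constructor
  · let Q : Submodule (MonoidAlgebra k Γ) (D.Mtr k) :=
      MonoidAlgebra.submoduleOfSMulMem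
        ((⨆ (K : Set D.W) (_ : J ⊂ K ∧ K ⊆ S), D.cycles k K).comap (D.chamberFn k).toLinearMap)
        fun g v hv => by
          rw [Submodule.mem_comap, LinearEquiv.coe_coe] at hv ⊢
          rw [chamberFn_of_smul]
          have h1 : (⨆ (K : Set D.W) (_ : J ⊂ K ∧ K ⊆ S), D.cycles k K) ≤
              (⨆ (K : Set D.W) (_ : J ⊂ K ∧ K ⊆ S), D.cycles k K).comap (trans k D.B g) :=
            iSup₂_le fun K hK f hf => Submodule.mem_iSup_of_mem K
              (Submodule.mem_iSup_of_mem hK (D.trans_mem_cycles k hf g))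
          exact h1 hv
    have h : D.MtrJ' k S J ≤ Q := iSup₂_le fun K hK y hy =>
      Submodule.mem_iSup_of_mem K (Submodule.mem_iSup_of_mem hK ((hD.mem_MtrJ k hK.2 y).1 hy))
    exact fun hx => h hx
  · intro hx
    have h : (⨆ (K : Set D.W) (_ : J ⊂ K ∧ K ⊆ S), D.cycles k K) ≤
        ((D.MtrJ' k S J).restrictScalars k).comap (D.chamberFn k).symm.toLinearMap :=
      iSup₂_le fun K hK f hf => by
        have h1 : (D.chamberFn k).symm f ∈ D.MtrJ k S K := by
          rw [hD.mem_MtrJ k hK.2, LinearEquiv.apply_symm_apply]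
          exact hf
        exact (le_iSup₂_of_le (f := fun (K : Set D.W) (_ : J ⊂ K ∧ K ⊆ S) => D.MtrJ k S K)
          K hK le_rfl) h1
    have h2 := h hx
    rw [Submodule.mem_comap, LinearEquiv.coe_coe, LinearEquiv.symm_apply_apply] at h2
    exact h2

/-- Each chamber `wB` with `w ∈ W_J` lies on a minimal gallery from `B` to `nB`, so it is fixed
along with both ends. -/
theorem altSum_fixed {J : Set D.W} (hJ : J ⊆ S) {n : D.N}
    (hn : ∀ t ∈ J, wordLen S (t * D.toW n) < wordLen S (D.toW n)) {b : Γ}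
    (hb : b ∈ D.B ⊓ D.stab n) : trans k D.B b (D.altSum k S J) = D.altSum k S J := by
  rw [trans_altSum, altSum]
  refine Finset.sum_congr rfl fun w hw => ?_
  have hw' : w ∈ Subgroup.closure J := by simpa using hw
  have h1 := hD.isFolding.len_of_descent hJ hn hw'
  have h2 : b ∈ D.stab (D.rep w) := by
    refine hD.mem_stab_of_mem_stab_mul (v := w) (w := w⁻¹ * D.toW n)
      (h := (D.rep w : Γ)⁻¹ * n) ?_ (D.rep_mem_cell w) ?_ hb.1 ?_
    · rw [mul_inv_cancel_left]
      omega
    · have h3 := mem_cell_toW ((D.rep w)⁻¹ * n)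
      rwa [map_mul, map_inv, toW_rep] at h3
    · rw [mul_inv_cancel_left]
      exact hb.2
  congr 2
  rw [eq_comm, QuotientGroup.eq, ← mul_assoc]
  exact mem_stab.1 h2

theorem exists_relIndex_ne_zero {J K : Set D.W} (hJ : J ⊆ S) (hK : K ⊆ S)
    (φ : D.E k S J ≃ₗ[MonoidAlgebra k Γ] D.E k S K) {n : D.N}
    (hn : ∀ t ∈ J, wordLen S (t * D.toW n) < wordLen S (D.toW n)) :
    ∃ y, (∀ t ∈ K, wordLen S (y * t) < wordLen S y) ∧ ∃ g ∈ D.cell y,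
      (D.B ⊓ D.stab g).relIndex (D.B ⊓ D.stab n) ≠ 0 := by
  have h1 : (D.chamberFn k).symm (D.altSum k S J) ∈ D.MtrJ k S J := by
    rw [hD.mem_MtrJ k hJ, LinearEquiv.apply_symm_apply]
    exact hD.altSum_mem_cycles k hJ
  set e : D.MtrJ k S J := ⟨_, h1⟩ with he
  obtain ⟨m, hm⟩ := Submodule.Quotient.mk_surjective _ (φ (Submodule.Quotient.mk e))
  have hmK : D.chamberFn k m ∈ D.cycles k K := (hD.mem_MtrJ k hK _).1 m.2
  have hm0 : (m : D.Mtr k) ∉ D.MtrJ' k S K := by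
    intro h
    have h2 : (Submodule.Quotient.mk m : D.E k S K) = 0 :=
      (Submodule.Quotient.mk_eq_zero _).2 h
    rw [h2, eq_comm, LinearEquiv.map_eq_zero_iff, Submodule.Quotient.mk_eq_zero] at hm
    have h3 : (e : D.Mtr k) ∈ D.MtrJ' k S J := hm
    rw [hD.mem_MtrJ' k, he, LinearEquiv.apply_symm_apply] at h3
    exact hD.altSum_notMem k hJ h3
  have hpush : ∀ f ∈ ⨆ (K' : Set D.W) (_ : K ⊂ K' ∧ K' ⊆ S), D.cycles k K',
      D.push k (S \ K) f = 0 := by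
    have h1 : (⨆ (K' : Set D.W) (_ : K ⊂ K' ∧ K' ⊆ S), D.cycles k K') ≤
        LinearMap.ker (D.push k (S \ K)) := D.iSup_cycles_le_ker_push k
    exact fun f hf => h1 hf
  -- The representative `m` is fixed only modulo `M(tr)'_K`; its residue sums are fixed exactly.
  have hfix : ∀ b ∈ D.B ⊓ D.stab n, trans k _ b (D.push k (S \ K) (D.chamberFn k m)) =
      D.push k (S \ K) (D.chamberFn k m) := by
    intro b hb
    have h2 : MonoidAlgebra.of k Γ b • e = e := by
      ext
      apply (D.chamberFn k).injective
      rw [Submodule.coe_smul, chamberFn_of_smul, he, LinearEquiv.apply_symm_apply,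
        hD.altSum_fixed k hJ hn hb]
    have h3 : (Submodule.Quotient.mk (MonoidAlgebra.of k Γ b • m) : D.E k S K) =
        Submodule.Quotient.mk m := by
      rw [Submodule.Quotient.mk_smul, hm, ← map_smul, ← Submodule.Quotient.mk_smul, h2]
    rw [Submodule.Quotient.eq] at h3
    have h4 : ((MonoidAlgebra.of k Γ b • m - m : D.MtrJ k S K) : D.Mtr k) ∈ D.MtrJ' k S K := h3
    rw [hD.mem_MtrJ' k, Submodule.coe_sub, Submodule.coe_smul, map_sub, chamberFn_of_smul] at h4
    have h5 := hpush _ h4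
    rwa [map_sub, push_trans, sub_eq_zero] at h5
  have h2 : ∃ y, (∀ t ∈ K, wordLen S (y * t) < wordLen S y) ∧ ∃ g ∈ D.cell y,
      D.push k (S \ K) (D.chamberFn k m) (g : Γ ⧸ D.parabolic (S \ K)) ≠ 0 ∧
        ∀ t ∈ S \ K, wordLen S y < wordLen S (y * t) := by
    by_contra! H
    exact hm0 ((hD.mem_MtrJ' k _).2 (hD.mem_iSup_cycles k hK hmK fun y hy hy' g hg => by
      by_contra h3
      obtain ⟨t, ht, h4⟩ := H y hy g hg h3
      exact absurd (hy' t ht) (by omega)))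
  obtain ⟨y, hy, g, hg, hne, hy'⟩ := h2
  exact ⟨y, hy, g, hg, hD.relIndex_ne_zero_of_push k Set.sdiff_subset inf_le_left hfix hy' hg hne⟩

theorem subset_of_equiv {C : Subgroup Γ → Prop} (hC : IsNoetherianClass C) (hB : C D.B)
    (hU : ∀ s ∈ S, (D.Uof S s : Set Γ).Infinite) {J K : Set D.W} (hJ : J ⊆ S) (hK : K ⊆ S)
    (φ : D.E k S J ≃ₗ[MonoidAlgebra k Γ] D.E k S K) : K ⊆ J := by
  obtain ⟨wJ, hwJ, hJl, -⟩ := hD.isFolding.exists_longest hJ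
  obtain ⟨wK, hwK, hKl, -⟩ := hD.isFolding.exists_longest hK
  obtain ⟨nJ, rfl⟩ := D.toW_surjective wJ
  obtain ⟨nK, rfl⟩ := D.toW_surjective wK
  obtain ⟨y, hy, g, hg, h⟩ := hD.exists_relIndex_ne_zero k hJ hK φ hJl
  obtain ⟨y', hy', g', hg', h'⟩ := hD.exists_relIndex_ne_zero k hK hJ φ.symm hKl
  exact hD.subset_of_relIndex hC hB hU hJ hK hwJ hwK hKl hy hg h hy' hg' h'

end IsBNPair

end BNTriple

/-! ### Zariski closed subgroups satisfy the chain condition. -/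

section Zariski

variable {F : Type*} [Field F] {n : ℕ}

theorem IsZariskiClosed.comap_conj {H : Subgroup (GL (Fin n) F)} (hH : IsZariskiClosed H)
    (g : GL (Fin n) F) : IsZariskiClosed (H.comap (MulAut.conj g).toMonoidHom) := by
  obtain ⟨I, hI⟩ := hH
  -- The entries of `g x g⁻¹` as polynomials in those of `x`.
  let f : Fin n × Fin n → MvPolynomial (Fin n × Fin n) F := fun ij =>
    ∑ b, (∑ a, MvPolynomial.C ((g : Matrix (Fin n) (Fin n) F) ij.1 a) * MvPolynomial.X (a, b)) *
      MvPolynomial.C (((g⁻¹ : GL (Fin n) F) : Matrix (Fin n) (Fin n) F) b ij.2)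
  refine ⟨MvPolynomial.bind₁ f '' I, fun x => ?_⟩
  have h1 : ∀ p, MvPolynomial.eval (fun ij => (x : Matrix (Fin n) (Fin n) F) ij.1 ij.2)
      (MvPolynomial.bind₁ f p) = MvPolynomial.eval (fun ij =>
        ((g * x * g⁻¹ : GL (Fin n) F) : Matrix (Fin n) (Fin n) F) ij.1 ij.2) p := by
    intro p
    rw [← MvPolynomial.coe_aeval_eq_eval, ← MvPolynomial.coe_aeval_eq_eval]
    simp only [RingHom.coe_coe]
    rw [MvPolynomial.aeval_bind₁]
    congr 2
    ext ij
    simp [f, Matrix.mul_apply]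
  rw [Subgroup.mem_comap, Set.forall_mem_image]
  simp only [h1]
  exact hI _

theorem IsZariskiClosed.inf {H K : Subgroup (GL (Fin n) F)} (hH : IsZariskiClosed H)
    (hK : IsZariskiClosed K) : IsZariskiClosed (H ⊓ K) := by
  obtain ⟨I, hI⟩ := hH
  obtain ⟨I', hI'⟩ := hK
  refine ⟨I ∪ I', fun g => ?_⟩
  rw [Subgroup.mem_inf, hI, hI']
  simp only [Set.mem_union, or_imp, forall_and]

/-- The ideal of polynomials in the matrix entries that vanish on `H`. -/
noncomputable def vanishingPolynomials (H : Subgroup (GL (Fin n) F)) :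
    Ideal (MvPolynomial (Fin n × Fin n) F) :=
  ⨅ g ∈ H, RingHom.ker (MvPolynomial.eval
    fun ij : Fin n × Fin n => (g : Matrix (Fin n) (Fin n) F) ij.1 ij.2)

theorem IsZariskiClosed.le_of_vanishing_le {H K : Subgroup (GL (Fin n) F)}
    (hH : IsZariskiClosed H) (h : vanishingPolynomials H ≤ vanishingPolynomials K) : K ≤ H := by
  obtain ⟨I, hI⟩ := hH
  intro g hg
  rw [hI]
  intro p hp
  have h1 : p ∈ vanishingPolynomials H := by
    simp only [vanishingPolynomials, Submodule.mem_iInf, RingHom.mem_ker]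
    exact fun x hx => (hI x).1 hx p hp
  have h2 := h h1
  simp only [vanishingPolynomials, Submodule.mem_iInf, RingHom.mem_ker] at h2
  exact h2 g hg

/-- Passing to vanishing ideals strictly reverses inclusions of closed subgroups, and the polynomial
ring is Noetherian. -/
theorem wellFounded_isZariskiClosed :
    WellFounded fun H K : {H : Subgroup (GL (Fin n) F) // IsZariskiClosed H} => H < K := by
  refine Subrelation.wf (r := InvImage (· > ·) fun H => vanishingPolynomials H.1) ?_
    (InvImage.wf _ IsWellFounded.wf)
  intro H K hHK
  refine lt_of_le_not_ge ?_ fun h => ?_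
  · exact biInf_mono fun g hg => hHK.le hg
  · exact hHK.not_ge (H.2.le_of_vanishing_le h)

theorem isNoetherianClass_isZariskiClosed (G : Subgroup (GL (Fin n) F)) :
    IsNoetherianClass fun H : Subgroup G => IsZariskiClosed (H.map G.subtype) where
  conj H hH g := by
    have h1 : (H.comap (MulAut.conj g).toMonoidHom).map G.subtype =
        (H.map G.subtype).comap (MulAut.conj (g : GL (Fin n) F)).toMonoidHom := by
      ext x
      constructor
      · rintro ⟨y, hy, rfl⟩
        exact ⟨_, hy, by simp⟩
      · rintro ⟨y, hy, hyx⟩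
        have hyx' : (y : GL (Fin n) F) = g * x * (g : GL (Fin n) F)⁻¹ := by simpa using hyx
        refine ⟨g⁻¹ * y * g, ?_, ?_⟩
        · simpa [mul_assoc] using hy
        · simp [hyx', mul_assoc]
    rw [h1]
    exact hH.comap_conj _
  inf H K hH hK := by
    rw [Subgroup.map_inf _ _ _ G.subtype_injective]
    exact hH.inf hK
  wf := by
    refine Subrelation.wf (r := InvImage (· < ·)
      fun H : {H : Subgroup G // IsZariskiClosed (H.map G.subtype)} =>
        (⟨H.1.map G.subtype, H.2⟩ : {H : Subgroup (GL (Fin n) F) // IsZariskiClosed H})) ?_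
      (InvImage.wf _ wellFounded_isZariskiClosed)
    intro H K hHK
    exact (Subgroup.map_lt_map_iff_of_injective G.subtype_injective).2 hHK

theorem IsSplitBNPair.isBNPair {G : Subgroup (GL (Fin n) F)} {D : BNTriple G} {S : Set D.W}
    (hD : IsSplitBNPair G D S) : D.IsBNPair S where
  generate := hD.generate
  generate_W := hD.generate_W
  order_two := hD.order_two
  thick := hD.thick
  exchange := hD.exchange
  U_le_B := hD.U_le_B
  normal_U := hD.normal_U
  T_inf_U := hD.T_inf_U
  T_sup_U := hD.T_sup_U
  saturated := hD.saturated

end Zariski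

theorem proposition2p7 {F : Type*} [Field F] [IsAlgClosed F] {n : ℕ}
    (G : Subgroup (GL (Fin n) F)) (hG : IsZariskiClosed G)
    (D : BNTriple ↥G) (S : Set D.W) (hD : IsSplitBNPair G D S)
    (k : Type*) [Field k]
    (hU : ∀ s ∈ S, (D.Uof S s : Set ↥G).Infinite) :
    (∀ J ⊆ S, ∀ g : ↥G, ∀ x ∈ D.kUWEta k S J, D.ind k g x ∈ D.kUWEta k S J) ∧
    (∀ J ⊆ S, D.MtrJ' k S J ≤ D.MtrJ k S J) ∧
    (∀ J ⊆ S, ∀ K ⊆ S, J ≠ K →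
      IsEmpty (D.E k S J ≃ₗ[MonoidAlgebra k ↥G] D.E k S K)) := by
  have hBN := hD.isBNPair
  have hC := isNoetherianClass_isZariskiClosed G
  have := hBN.finite_W hC hD.closed_B
  refine ⟨fun J hJ g x hx => hBN.ind_mem_kUWEta k hJ g hx, fun J _ => hBN.MtrJ'_le k,
    fun J hJ K hK hne => ⟨fun φ => hne ?_⟩⟩
  exact Set.Subset.antisymm (hBN.subset_of_equiv k hC hD.closed_B hU hK hJ φ.symm)
    (hBN.subset_of_equiv k hC hD.closed_B hU hJ hK φ)
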